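/- A weight is a nonnegative measurable function $w$ on $(0,\infty)$ with $W(t)=\int_0^t w(s)\,ds<\infty$ for all $t>0$. Write $A\approx B$ if $C^{-1}A\le B\le CA$ for some constant $C>1$ independent of the variables. The weight $w$ belongs to $B_1$ if there is $C<\infty$ such that $\int_r^\infty \frac{w(s)}{s}\,ds\le \frac{C}{r}\int_0^r w(s)\,ds$ for all $r>0$. For a measurable $f:\mathbb R^n\to[0,\infty)$, $n\ge 1$, let $f^*$ be its decreasing rearrangement and $f^{**}(t)=\frac1t\int_0^t f^*(s)\,ds$. For $0<p,q<\infty$ let $\Gamma^{p,q}(w)$ be the space of measurable $f:\mathbb R^n\to[0,\infty)$ with $$\|f\|_{\Gamma^{p,q}(w)}=\Big(\int_0^\infty f^{**}(t)^q\,W(t)^{q/p-1}w(t)\,dt\Big)^{1/q}<\infty ,$$ and $\Gamma^q(w)=\Gamma^{q,q}(w)$. For $1<q<\infty$, a weight $w_q$ is said to be associated with $w$ and $q$ if $$\Big(\int_0^r w(x)\,dx\Big)^q\approx \int_0^r w_q(x)\,dx+r^q\int_r^\infty w_q(x)\,\frac{dx}{x^q},\qquad r>0 .$$ Proposition. Let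 $w$ be a decreasing (that is, nonincreasing) weight. Then the following are equivalent: (i) $w\in B_1$; (ii) for every $1<q<\infty$ there is an associated weight $w_q$ such that $\Gamma^{1,q}(w)=\Gamma^q(w_q)$ as sets; (iii) for every $1<q<\infty$ an associated weight $w_q$ exists, and for every such $w_q$ one has $\Gamma^{1,q}(w)=\Gamma^q(w_q)$ with equivalent norms: $\|f\|_{\Gamma^{1,q}(w)}\approx\|f\|_{\Gamma^q(w_q)}$ for all measurable $f:\mathbb R^n\to[0,\infty)$. -/

import Mathlib

open MeasureTheory Set
open scoped NNReal ENNReal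

namespace Lorentz

/-- A weight on `(0, ∞)`: a nonnegative measurable function, integrable on every `(0, t]`.
Only the values on `(0, ∞)` matter. -/
def IsWeight (w : ℝ → ℝ≥0) : Prop :=
  AEMeasurable w (volume.restrict (Ioi 0)) ∧
    ∀ t : ℝ, 0 < t → ∫⁻ s in Ioc 0 t, (w s : ℝ≥0∞) < ∞

/-- The primitive `W(t) = ∫₀ᵗ w(s) ds`. -/
noncomputable def primitive (w : ℝ → ℝ≥0) (t : ℝ) : ℝ≥0∞ :=
  ∫⁻ s in Ioc 0 t, (w s : ℝ≥0∞)

/-- `A ≈ B` on `S`: there is a constant `C > 1` with `C⁻¹ A ≤ B ≤ C A` at all points of `S`. -/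
def EquivalentOn {ι : Type*} (S : Set ι) (A B : ι → ℝ≥0∞) : Prop :=
  ∃ C : ℝ≥0, 1 < C ∧ ∀ i ∈ S, (C : ℝ≥0∞)⁻¹ * A i ≤ B i ∧ B i ≤ (C : ℝ≥0∞) * A i

/-- The class `B_p`: for some finite constant `C` and all `r > 0`,
`∫_r^∞ w(s) / s^p ds ≤ (C / r^p) ∫_0^r w(s) ds`. -/
def MemB (p : ℝ) (w : ℝ → ℝ≥0) : Prop :=
  ∃ C : ℝ≥0, ∀ r : ℝ, 0 < r →
    ∫⁻ s in Ioi r, (w s : ℝ≥0∞) / ENNReal.ofReal s ^ p ≤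
      (C : ℝ≥0∞) / ENNReal.ofReal r ^ p * ∫⁻ s in Ioc 0 r, (w s : ℝ≥0∞)

/-- The decreasing rearrangement
`f^*(t) = inf {l ≥ 0 : |{x : f(x) > l}| ≤ t}` of a nonnegative function on `ℝⁿ`. -/
noncomputable def rearrangement {n : ℕ} (f : EuclideanSpace ℝ (Fin n) → ℝ≥0) (t : ℝ) : ℝ≥0∞ :=
  sInf {l : ℝ≥0∞ | volume {x | l < (f x : ℝ≥0∞)} ≤ ENNReal.ofReal t}

/-- The maximal function `f^{**}(t) = (1/t) ∫₀ᵗ f^*(s) ds`, `t > 0`. -/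
noncomputable def maximalFunction {n : ℕ} (f : EuclideanSpace ℝ (Fin n) → ℝ≥0) (t : ℝ) : ℝ≥0∞ :=
  (ENNReal.ofReal t)⁻¹ * ∫⁻ s in Ioc 0 t, rearrangement f s

/-- The functional
`‖f‖_{Γ^{p,q}(w)} = (∫₀^∞ f^{**}(t)^q W(t)^{q/p - 1} w(t) dt)^{1/q}`, for `0 < p, q < ∞`. -/
noncomputable def gammaNorm {n : ℕ} (p q : ℝ) (w : ℝ → ℝ≥0)
    (f : EuclideanSpace ℝ (Fin n) → ℝ≥0) : ℝ≥0∞ :=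
  (∫⁻ t in Ioi (0 : ℝ),
    maximalFunction f t ^ q * primitive w t ^ (q / p - 1) * (w t : ℝ≥0∞)) ^ (1 / q)

/-- The space `Γ^{p,q}(w)` of nonnegative (Lebesgue) measurable functions on `ℝⁿ`.
One writes `Γ^q(w)` for `Γ^{q,q}(w)`. -/
def GammaSpace (n : ℕ) (p q : ℝ) (w : ℝ → ℝ≥0) : Set (EuclideanSpace ℝ (Fin n) → ℝ≥0) :=
  {f | AEMeasurable f volume ∧ gammaNorm p q w f < ∞}

/-- `v` is a weight `w_q` associated with `w` and `q`: for `r > 0`,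
`(∫₀^r w)^q ≈ ∫₀^r v + r^q ∫_r^∞ v(x) / x^q dx`. -/
def IsAssociatedWeight (q : ℝ) (w v : ℝ → ℝ≥0) : Prop :=
  IsWeight v ∧
    EquivalentOn (Ioi (0 : ℝ)) (fun r => primitive w r ^ q)
      (fun r => primitive v r +
        ENNReal.ofReal r ^ q * ∫⁻ x in Ioi r, (v x : ℝ≥0∞) / ENNReal.ofReal x ^ q)

end Lorentz

namespace Lorentz

/-! Put `u = W^(q-1) w` and `φ_v(r) = ∫_0^r v + r^q ∫_r^∞ v x^(-q)`. Since `Γ^{1,q}(w) = Γ^q(u)`,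
the task is to compare two `Γ^q` spaces, and up to constants the norm of `Γ^q(v)` depends only on
`φ_v`. Indeed `(∫_0^t f^*)^q ≈ ∫_0^t g(s) s^(q-1) ds` with `g = (f^{**})^(q-1) f^*` decreasing. By
Tonelli the `q`-th power of the norm is then comparable to the integral of `g` against `s^(q-1)
∫_s^∞ v x^(-q) dx`, a density whose primitive is comparable to `φ_v`. Hardy's lemma turns `φ_v ≤ C
φ_u` into an inequality of norms (`gammaIntegral_le_of_fundamental_le`).

A weight `v` is associated exactly when `φ_v ≈ W^q`. If `w ∈ B_1`, then `u` is associated because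
`W(t)/t` decreases, so every associated weight gives a norm equivalent to that of `u`.

Conversely, one `q` and the inclusion `Γ^q(v) ⊆ Γ^q(u)` suffice. A gliding hump argument makes the
inclusion quantitative (`fundamental_le_of_subset`), so `φ_u ≤ K W^q`. Then `W(t)/t` cannot stay
above half its value at `r` over many blocks `(4^k r, 4^(k+1) r]`, since each contributes a fixed
multiple of `(W(r)/r)^q` to `∫_r^∞ u x^(-q)`. Thus the average halves under a fixed dilation, and a
geometric series gives `B_1`. -/

/-! ### Hardy's lemma -/

/-- A comparison of two measures on the intervals `(0, r]` extends to all initial segments. -/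
theorem measure_initial_le {μ ν : Measure ℝ} {C : ℝ≥0∞}
    (h : ∀ r : ℝ, 0 < r → μ (Ioc 0 r) ≤ C * ν (Ioc 0 r)) {S : Set ℝ} (hS : S ⊆ Ioi 0)
    (hS' : ∀ x ∈ S, ∀ y, 0 < y → y ≤ x → y ∈ S) : μ S ≤ C * ν S := by
  by_cases hmax : ∃ m ∈ S, ∀ x ∈ S, x ≤ m
  · obtain ⟨m, hm, hm'⟩ := hmax
    have : S = Ioc 0 m := Subset.antisymm (fun x hx => ⟨hS hx, hm' x hx⟩)
      fun x hx => hS' m hm x hx.1 hx.2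
    rw [this]
    exact h m (hS hm)
  · push Not at hmax
    -- Without a maximum, `S` is exhausted by intervals with rational endpoints; countability of the
    -- family allows continuity from below.
    have hU : S = ⋃ q : {q : ℚ // (q : ℝ) ∈ S}, Ioc (0 : ℝ) (q : ℚ) := by
      ext x
      simp only [mem_iUnion, mem_Ioc]
      constructor
      · intro hx
        obtain ⟨y, hy, hxy⟩ := hmax x hx
        obtain ⟨q, hq, hq'⟩ := exists_rat_btwn hxy
        exact ⟨⟨q, hS' y hy q ((hS hx).trans hq) hq'.le⟩, hS hx, hq.le⟩
      · rintro ⟨q, h0, hq⟩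
        exact hS' _ q.2 x h0 hq
    have hd : Directed (· ⊆ ·) fun q : {q : ℚ // (q : ℝ) ∈ S} => Ioc (0 : ℝ) (q : ℚ) := by
      intro a b
      rcases le_total (a : ℚ) b with hab | hab
      · exact ⟨b, Ioc_subset_Ioc_right (by exact_mod_cast hab), subset_rfl⟩
      · exact ⟨a, subset_rfl, Ioc_subset_Ioc_right (by exact_mod_cast hab)⟩
    have hμ : μ S = ⨆ q : {q : ℚ // (q : ℝ) ∈ S}, μ (Ioc (0 : ℝ) (q : ℚ)) := by
      conv_lhs => rw [hU]
      exact hd.measure_iUnion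
    rw [hμ]
    refine iSup_le fun q => (h _ (hS q.2)).trans ?_
    gcongr
    exact fun x hx => hS' _ q.2 x hx.1 hx.2

/-- Layer cake: the superlevel sets of a decreasing function are initial segments, where the
measures compare. Truncation at `n` makes the function real-valued, as the layer cake formula
requires. -/
theorem lintegral_min_natCast_le {μ ν : Measure ℝ} {C : ℝ≥0∞} (hC : C ≠ ∞)
    (h : ∀ r : ℝ, 0 < r → μ (Ioc 0 r) ≤ C * ν (Ioc 0 r)) {k : ℝ → ℝ≥0∞}
    (hk : AntitoneOn k (Ioi 0)) (n : ℕ) :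
    ∫⁻ x in Ioi 0, min (k x) n ∂μ ≤ C * ∫⁻ x in Ioi 0, min (k x) n ∂ν := by
  have hka : AntitoneOn (fun x => (min (k x) n).toReal) (Ioi 0) := fun x hx y hy hxy =>
    ENNReal.toReal_mono (ne_top_of_le_ne_top (ENNReal.natCast_ne_top n) (min_le_right _ _))
      (min_le_min_right _ (hk hx hy hxy))
  have hlc : ∀ ρ : Measure ℝ, ∫⁻ x in Ioi 0, min (k x) n ∂ρ =
      ∫⁻ t in Ioi (0 : ℝ), ρ ({x | t < (min (k x) n).toReal} ∩ Ioi 0) := by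
    intro ρ
    have h1 := lintegral_eq_lintegral_meas_lt (ρ.restrict (Ioi 0))
      (Filter.Eventually.of_forall fun x => ENNReal.toReal_nonneg)
      (aemeasurable_restrict_of_antitoneOn measurableSet_Ioi hka)
    simp_rw [Measure.restrict_apply' measurableSet_Ioi] at h1
    rw [← h1]
    refine lintegral_congr fun x => (ENNReal.ofReal_toReal ?_).symm
    exact ne_top_of_le_ne_top (ENNReal.natCast_ne_top n) (min_le_right _ _)
  rw [hlc, hlc]
  rw [← lintegral_const_mul' _ _ hC]
  refine lintegral_mono fun t => ?_
  exact measure_initial_le h inter_subset_right fun x hx y hy hyx =>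
    ⟨lt_of_lt_of_le hx.1 (hka hy hx.2 hyx), hy⟩

/-- **Hardy's lemma.** -/
theorem lintegral_le_of_antitoneOn {μ ν : Measure ℝ} {C : ℝ≥0∞} (hC : C ≠ ∞)
    (h : ∀ r : ℝ, 0 < r → μ (Ioc 0 r) ≤ C * ν (Ioc 0 r)) {k : ℝ → ℝ≥0∞}
    (hk : AntitoneOn k (Ioi 0)) :
    ∫⁻ x in Ioi 0, k x ∂μ ≤ C * ∫⁻ x in Ioi 0, k x ∂ν := by
  have hsup : ∀ x, k x = ⨆ n : ℕ, min (k x) n := fun x => by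
    rw [← inf_iSup_eq, ENNReal.iSup_natCast, inf_top_eq]
  have hint : ∫⁻ x in Ioi 0, k x ∂μ = ⨆ n : ℕ, ∫⁻ x in Ioi 0, min (k x) n ∂μ := by
    rw [← lintegral_iSup']
    · exact lintegral_congr hsup
    · intro n
      exact (aemeasurable_restrict_of_antitoneOn measurableSet_Ioi hk).min aemeasurable_const
    · refine Filter.Eventually.of_forall fun x m n hmn => ?_
      simp only
      gcongr
  rw [hint]
  refine iSup_le fun n => (lintegral_min_natCast_le hC h hk n).trans ?_
  gcongr
  exact min_le_left _ _

/-! ### Primitives and averages of decreasing functions -/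

/-- A decreasing function can fail to be integrable only at `0`: a finite integral over `(0, s]`
forces `f s < ∞`, which bounds `f` on `(s, t]`. -/
theorem primitive_eq_top_of_antitoneOn {f : ℝ → ℝ≥0∞} (hf : AntitoneOn f (Ioi 0)) {t s : ℝ}
    (ht : ∫⁻ x in Ioc 0 t, f x = ∞) (hs : 0 < s) (hst : s ≤ t) : ∫⁻ x in Ioc 0 s, f x = ∞ := by
  by_contra hne
  have hfs : f s ≠ ∞ := by
    intro hfs
    refine hne (top_unique ?_)
    calc (∞ : ℝ≥0∞) = ∫⁻ x in Ioc 0 s, f s := by simp [hfs, hs, ENNReal.top_mul]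
      _ ≤ _ := setLIntegral_mono' measurableSet_Ioc fun x hx => hf hx.1 hs hx.2
  have hsplit : ∫⁻ x in Ioc 0 t, f x = (∫⁻ x in Ioc 0 s, f x) + ∫⁻ x in Ioc s t, f x := by
    rw [← Ioc_union_Ioc_eq_Ioc hs.le hst,
      lintegral_union measurableSet_Ioc (Ioc_disjoint_Ioc_of_le le_rfl)]
  have hle : ∫⁻ x in Ioc s t, f x ≤ ∫⁻ x in Ioc s t, f s :=
    setLIntegral_mono' measurableSet_Ioc fun x hx => hf hs (hs.trans hx.1) hx.1.le
  rw [setLIntegral_const, Real.volume_Ioc] at hle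
  rw [hsplit, ENNReal.add_eq_top] at ht
  rcases ht with ht | ht
  · exact hne ht
  · exact (ENNReal.mul_lt_top hfs.lt_top ENNReal.ofReal_lt_top).ne (top_unique (ht ▸ hle))

theorem exists_primitive_eq_half {f : ℝ → ℝ≥0∞} (hf : AntitoneOn f (Ioi 0)) {t : ℝ} (ht : 0 < t)
    (hfin : ∫⁻ x in Ioc 0 t, f x ≠ ∞) :
    ∃ s ∈ Icc 0 t, ∫⁻ x in Ioc 0 s, f x = (∫⁻ x in Ioc 0 t, f x) / 2 := by
  have hm : AEMeasurable f (volume.restrict (Ioc 0 t)) :=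
    (aemeasurable_restrict_of_antitoneOn measurableSet_Ioi hf).mono_measure
      (Measure.restrict_mono Ioc_subset_Ioi_self le_rfl)
  have hfin' : ∀ s ≤ t, ∫⁻ x in Ioc 0 s, f x ≠ ∞ := fun s hs =>
    ne_top_of_le_ne_top hfin (lintegral_mono_set (Ioc_subset_Ioc_right hs))
  have hreal : ∀ s ≤ t, ∫ x in Ioc 0 s, (f x).toReal = (∫⁻ x in Ioc 0 s, f x).toReal := by
    intro s hs
    have hms := hm.mono_measure (Measure.restrict_mono (Ioc_subset_Ioc_right hs) le_rfl)
    exact integral_toReal hms (ae_lt_top' hms (hfin' s hs))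
  have hint : IntegrableOn (fun x => (f x).toReal) (Icc 0 t) := by
    rw [integrableOn_Icc_iff_integrableOn_Ioc]
    exact integrable_toReal_of_lintegral_ne_top hm hfin
  have hcont := intervalIntegral.continuousOn_primitive hint
  obtain ⟨s, hs, hs'⟩ := intermediate_value_Icc ht.le hcont
    (show (∫⁻ x in Ioc 0 t, f x).toReal / 2 ∈ Icc _ _ by
      rw [hreal t le_rfl, hreal 0 ht.le]
      have := ENNReal.toReal_nonneg (a := ∫⁻ x in Ioc 0 t, f x)
      simp only [Ioc_self, Measure.restrict_empty, lintegral_zero_measure, ENNReal.toReal_zero,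
        mem_Icc]
      constructor <;> linarith)
  refine ⟨s, hs, ?_⟩
  simp only [] at hs'
  rw [hreal s hs.2] at hs'
  rw [← ENNReal.toReal_eq_toReal_iff' (hfin' s hs.2) (ENNReal.div_ne_top hfin two_ne_zero), hs',
    ENNReal.toReal_div]
  rfl

/-- Up to a constant, `F ^ q` is the integral of `F ^ (q - 1) * f` where `F` is the primitive
of `f`. -/
theorem primitive_rpow_le {f : ℝ → ℝ≥0∞} (hf : AntitoneOn f (Ioi 0)) {q : ℝ} (hq : 1 < q) {t : ℝ}
    (ht : 0 < t) : (∫⁻ x in Ioc 0 t, f x) ^ q ≤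
      2 ^ q * ∫⁻ s in Ioc 0 t, (∫⁻ x in Ioc 0 s, f x) ^ (q - 1) * f s := by
  have hm : AEMeasurable f (volume.restrict (Ioc 0 t)) :=
    (aemeasurable_restrict_of_antitoneOn measurableSet_Ioi hf).mono_measure
      (Measure.restrict_mono Ioc_subset_Ioi_self le_rfl)
  have hq0 : 0 < q := by linarith
  by_cases hfin : ∫⁻ x in Ioc 0 t, f x = ∞
  · have : ∫⁻ s in Ioc 0 t, (∫⁻ x in Ioc 0 s, f x) ^ (q - 1) * f s = ∞ := by
      rw [setLIntegral_congr_fun (g := fun s => ∞ * f s) measurableSet_Ioc fun s hs => by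
        simp only [primitive_eq_top_of_antitoneOn hf hfin hs.1 hs.2]
        rw [ENNReal.top_rpow_of_pos (by linarith)], lintegral_const_mul'' _ hm, hfin,
        ENNReal.top_mul_top]
    rw [this, ENNReal.mul_top (by simp)]
    exact le_top
  -- Beyond the point where the primitive reaches `F / 2`, its power is at least `(F / 2)^(q-1)` and
  -- `f` still carries mass `F / 2`. This replaces differentiation of `F^q`, at the cost of the
  -- constant `2^q`.
  · obtain ⟨s, hs, hs'⟩ := exists_primitive_eq_half hf ht hfin
    set F := ∫⁻ x in Ioc 0 t, f x with hF
    have hsplit : F = (∫⁻ x in Ioc 0 s, f x) + ∫⁻ x in Ioc s t, f x := by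
      rw [hF, ← Ioc_union_Ioc_eq_Ioc hs.1 hs.2,
        lintegral_union measurableSet_Ioc (Ioc_disjoint_Ioc_of_le le_rfl)]
    have hhalf : ∫⁻ x in Ioc s t, f x = F / 2 := by
      rw [hs'] at hsplit
      conv_lhs at hsplit => rw [← ENNReal.add_halves F]
      exact ((ENNReal.add_right_inj (ENNReal.div_ne_top hfin two_ne_zero)).1 hsplit).symm
    have hlow : (F / 2) ^ q ≤ ∫⁻ s in Ioc 0 t, (∫⁻ x in Ioc 0 s, f x) ^ (q - 1) * f s :=
      calc (F / 2) ^ q = (F / 2) ^ (q - 1) * ∫⁻ x in Ioc s t, f x := by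
            rw [hhalf]
            conv_rhs => rw [← ENNReal.rpow_one (F / 2), ← ENNReal.rpow_mul, one_mul]
            rw [← ENNReal.rpow_add_of_nonneg _ _ (by linarith) zero_le_one, sub_add_cancel]
        _ ≤ ∫⁻ x in Ioc s t, (F / 2) ^ (q - 1) * f x := lintegral_const_mul_le _ _
        _ ≤ ∫⁻ r in Ioc s t, (∫⁻ x in Ioc 0 r, f x) ^ (q - 1) * f r := by
            refine setLIntegral_mono' measurableSet_Ioc fun r hr => ?_
            gcongr
            rw [← hs']
            exact lintegral_mono_set (Ioc_subset_Ioc_right hr.1.le)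
        _ ≤ _ := lintegral_mono_set (Ioc_subset_Ioc_left hs.1)
    calc F ^ q = 2 ^ q * (F / 2) ^ q := by
          rw [← ENNReal.mul_rpow_of_nonneg _ _ hq0.le, ENNReal.mul_div_cancel two_ne_zero
            ENNReal.ofNat_ne_top]
      _ ≤ _ := by gcongr

theorem lintegral_primitive_rpow_mul_le {f : ℝ → ℝ≥0∞} (hf : AntitoneOn f (Ioi 0)) {q : ℝ}
    (hq : 1 < q) (t : ℝ) :
    ∫⁻ s in Ioc 0 t, (∫⁻ x in Ioc 0 s, f x) ^ (q - 1) * f s ≤ (∫⁻ x in Ioc 0 t, f x) ^ q := by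
  have hm : AEMeasurable f (volume.restrict (Ioc 0 t)) :=
    (aemeasurable_restrict_of_antitoneOn measurableSet_Ioi hf).mono_measure
      (Measure.restrict_mono Ioc_subset_Ioi_self le_rfl)
  calc _ ≤ ∫⁻ s in Ioc 0 t, (∫⁻ x in Ioc 0 t, f x) ^ (q - 1) * f s := by
        refine setLIntegral_mono' measurableSet_Ioc fun r hr => ?_
        gcongr
        exact hr.2
    _ = (∫⁻ x in Ioc 0 t, f x) ^ (q - 1) * (∫⁻ x in Ioc 0 t, f x) ^ (1 : ℝ) := by
        rw [lintegral_const_mul'' _ hm, ENNReal.rpow_one]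
    _ = _ := by
        rw [← ENNReal.rpow_add_of_nonneg _ _ (by linarith) zero_le_one, sub_add_cancel]

theorem le_average {f : ℝ → ℝ≥0∞} (hf : AntitoneOn f (Ioi 0)) {t : ℝ} (ht : 0 < t) :
    f t ≤ (ENNReal.ofReal t)⁻¹ * ∫⁻ s in Ioc 0 t, f s := by
  have h : ∫⁻ s in Ioc 0 t, f t ≤ ∫⁻ s in Ioc 0 t, f s :=
    setLIntegral_mono' measurableSet_Ioc fun x hx => hf hx.1 ht hx.2
  rw [setLIntegral_const, Real.volume_Ioc, sub_zero] at h
  rw [mul_comm, ← div_eq_mul_inv]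
  exact (ENNReal.le_div_iff_mul_le (.inl (by simpa using ht)) (.inl ENNReal.ofReal_ne_top)).2 h

theorem average_antitoneOn {f : ℝ → ℝ≥0∞} (hf : AntitoneOn f (Ioi 0)) :
    AntitoneOn (fun t => (ENNReal.ofReal t)⁻¹ * ∫⁻ s in Ioc 0 t, f s) (Ioi 0) := by
  intro s hs t ht hst
  have hs0 : ENNReal.ofReal s ≠ 0 := by simpa using hs
  have ht0 : ENNReal.ofReal t ≠ 0 := by simpa using ht
  set A := (ENNReal.ofReal s)⁻¹ * ∫⁻ x in Ioc 0 s, f x with hA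
  have hsA : ∫⁻ x in Ioc 0 s, f x = ENNReal.ofReal s * A := by
    rw [hA, ← mul_assoc, ENNReal.mul_inv_cancel hs0 ENNReal.ofReal_ne_top, one_mul]
  have hle : ∫⁻ x in Ioc s t, f x ≤ ENNReal.ofReal (t - s) * A := by
    refine (setLIntegral_mono' measurableSet_Ioc fun x hx =>
      (hf hs (lt_trans hs hx.1) hx.1.le).trans (le_average hf hs)).trans ?_
    rw [setLIntegral_const, Real.volume_Ioc, mul_comm]
  have htot : ∫⁻ x in Ioc 0 t, f x ≤ ENNReal.ofReal t * A := by
    rw [← Ioc_union_Ioc_eq_Ioc (le_of_lt hs) hst,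
      lintegral_union measurableSet_Ioc (Ioc_disjoint_Ioc_of_le le_rfl), hsA]
    refine (add_le_add_right hle _).trans_eq ?_
    rw [← add_mul, ← ENNReal.ofReal_add (le_of_lt hs) (sub_nonneg.2 hst), add_sub_cancel]
  calc (ENNReal.ofReal t)⁻¹ * ∫⁻ x in Ioc 0 t, f x
      ≤ (ENNReal.ofReal t)⁻¹ * (ENNReal.ofReal t * A) := by gcongr
    _ = A := by rw [← mul_assoc, ENNReal.inv_mul_cancel ht0 ENNReal.ofReal_ne_top, one_mul]

theorem rearrangement_antitone {n : ℕ} (f : EuclideanSpace ℝ (Fin n) → ℝ≥0) :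
    Antitone (rearrangement f) := fun _ _ hst =>
  sInf_le_sInf fun _ hl => le_trans hl (ENNReal.ofReal_le_ofReal hst)

/-! ### The fundamental function and its density -/

/-- The function `∫₀ʳ v + r^q ∫_r^∞ v(x) / x^q dx`. -/
noncomputable def fundamental (q : ℝ) (v : ℝ → ℝ≥0) (r : ℝ) : ℝ≥0∞ :=
  primitive v r + ENNReal.ofReal r ^ q * ∫⁻ x in Ioi r, (v x : ℝ≥0∞) / ENNReal.ofReal x ^ q

/-- Since `min x r` is the integral over `(0, x]` of the characteristic function of `(0, r)`, this
exhibits `φ_v(r)` as the `q`-th power of the norm of such a function. -/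
theorem fundamental_eq {q : ℝ} (hq : 0 < q) {v : ℝ → ℝ≥0} {r : ℝ} (hr : 0 < r) :
    fundamental q v r = ∫⁻ x in Ioi 0,
      (v x : ℝ≥0∞) / ENNReal.ofReal x ^ q * ENNReal.ofReal (min x r) ^ q := by
  have hr0 : ENNReal.ofReal r ^ q ≠ ∞ := ENNReal.rpow_ne_top_of_nonneg hq.le ENNReal.ofReal_ne_top
  rw [← Ioc_union_Ioi_eq_Ioi hr.le, lintegral_union measurableSet_Ioi Ioc_disjoint_Ioi_same,
    fundamental, primitive, ← lintegral_const_mul' _ _ hr0]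
  congr 1
  · refine setLIntegral_congr_fun measurableSet_Ioc fun x hx => ?_
    simp only [min_eq_left hx.2]
    rw [ENNReal.div_mul_cancel]
    · simpa [hq.not_gt] using fun h : x ≤ 0 => absurd hx.1 h.not_gt
    · exact ENNReal.rpow_ne_top_of_nonneg hq.le ENNReal.ofReal_ne_top
  · refine setLIntegral_congr_fun measurableSet_Ioi fun x hx => ?_
    simp only [min_eq_right (le_of_lt (mem_Ioi.1 hx))]
    rw [mul_comm]

/-- The density `s^(q-1) ∫_s^∞ v(x) / x^q dx` of the function `fundamental q v`. -/
noncomputable def tailDensity (q : ℝ) (v : ℝ → ℝ≥0) (s : ℝ) : ℝ≥0∞ :=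
  ENNReal.ofReal s ^ (q - 1) * ∫⁻ x in Ioi s, (v x : ℝ≥0∞) / ENNReal.ofReal x ^ q

theorem measurable_tailDensity (q : ℝ) (v : ℝ → ℝ≥0) : Measurable (tailDensity q v) :=
  (ENNReal.measurable_ofReal.pow_const _).mul
    (Antitone.measurable fun _ _ h => lintegral_mono_set (Ioi_subset_Ioi h))

theorem lintegral_mul_tailDensity {q : ℝ} {v : ℝ → ℝ≥0}
    (hv : AEMeasurable v (volume.restrict (Ioi 0))) {k : ℝ → ℝ≥0∞}
    (hk : AEMeasurable k (volume.restrict (Ioi 0))) :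
    ∫⁻ s in Ioi 0, k s * tailDensity q v s =
      ∫⁻ t in Ioi 0, (v t : ℝ≥0∞) / ENNReal.ofReal t ^ q *
        ∫⁻ s in Ioc 0 t, k s * ENNReal.ofReal s ^ (q - 1) := by
  have hv' : AEMeasurable (fun t => (v t : ℝ≥0∞) / ENNReal.ofReal t ^ q)
      (volume.restrict (Ioi 0)) := by fun_prop
  have hk' : AEMeasurable (fun s => k s * ENNReal.ofReal s ^ (q - 1))
      (volume.restrict (Ioi 0)) := by fun_prop
  have hS : MeasurableSet {p : ℝ × ℝ | p.1 ≤ p.2} := measurableSet_le measurable_fst measurable_snd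
  have hF : AEMeasurable (Function.uncurry fun s t : ℝ =>
      {p : ℝ × ℝ | p.1 ≤ p.2}.indicator (fun p => (k p.1 * ENNReal.ofReal p.1 ^ (q - 1)) *
        ((v p.2 : ℝ≥0∞) / ENNReal.ofReal p.2 ^ q)) (s, t))
      ((volume.restrict (Ioi 0)).prod (volume.restrict (Ioi 0))) :=
    (hk'.comp_fst.mul hv'.comp_snd).indicator hS
  have hswap := lintegral_lintegral_swap hF
  refine Eq.trans ?_ (hswap.trans ?_)
  · refine setLIntegral_congr_fun measurableSet_Ioi fun s hs => ?_
    have : ∀ t, {p : ℝ × ℝ | p.1 ≤ p.2}.indicator (fun p => (k p.1 * ENNReal.ofReal p.1 ^ (q - 1)) *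
        ((v p.2 : ℝ≥0∞) / ENNReal.ofReal p.2 ^ q)) (s, t) = (Ici s).indicator (fun t =>
        (k s * ENNReal.ofReal s ^ (q - 1)) * ((v t : ℝ≥0∞) / ENNReal.ofReal t ^ q)) t :=
      fun t => rfl
    simp only [this]
    rw [lintegral_indicator measurableSet_Ici, Measure.restrict_restrict measurableSet_Ici,
      inter_eq_left.2 (Ici_subset_Ioi.2 hs), setLIntegral_congr Ioi_ae_eq_Ici.symm,
      lintegral_const_mul'', tailDensity, mul_assoc]
    exact hv'.mono_measure (Measure.restrict_mono (Ioi_subset_Ioi (le_of_lt hs)) le_rfl)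
  · refine setLIntegral_congr_fun measurableSet_Ioi fun t ht => ?_
    have : ∀ s, {p : ℝ × ℝ | p.1 ≤ p.2}.indicator (fun p => (k p.1 * ENNReal.ofReal p.1 ^ (q - 1)) *
        ((v p.2 : ℝ≥0∞) / ENNReal.ofReal p.2 ^ q)) (s, t) = (Iic t).indicator (fun s =>
        (k s * ENNReal.ofReal s ^ (q - 1)) * ((v t : ℝ≥0∞) / ENNReal.ofReal t ^ q)) s :=
      fun t => rfl
    simp only [this]
    rw [lintegral_indicator measurableSet_Iic, Measure.restrict_restrict measurableSet_Iic,
      inter_comm, Ioi_inter_Iic, lintegral_mul_const'', mul_comm]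
    exact hk'.mono_measure (Measure.restrict_mono Ioc_subset_Ioi_self le_rfl)

/-- The case `f = 1` of the comparison for primitives; the exact value `a^q / q` is not needed. -/
theorem lintegral_rpow_sub_one_le {q : ℝ} (hq : 1 < q) (a : ℝ) :
    ∫⁻ s in Ioc 0 a, ENNReal.ofReal s ^ (q - 1) ≤ ENNReal.ofReal a ^ q := by
  simpa using lintegral_primitive_rpow_mul_le (f := fun _ => 1) (fun _ _ _ _ _ => le_rfl) hq a

theorem rpow_le_lintegral_rpow_sub_one {q : ℝ} (hq : 1 < q) {a : ℝ} (ha : 0 < a) :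
    ENNReal.ofReal a ^ q ≤ 2 ^ q * ∫⁻ s in Ioc 0 a, ENNReal.ofReal s ^ (q - 1) := by
  simpa using primitive_rpow_le (f := fun _ => 1) (fun _ _ _ _ _ => le_rfl) hq ha

theorem lintegral_tailDensity {q : ℝ} {v : ℝ → ℝ≥0}
    (hv : AEMeasurable v (volume.restrict (Ioi 0))) (r : ℝ) :
    ∫⁻ s in Ioc 0 r, tailDensity q v s =
      ∫⁻ t in Ioi 0, (v t : ℝ≥0∞) / ENNReal.ofReal t ^ q *
        ∫⁻ s in Ioc 0 (min t r), ENNReal.ofReal s ^ (q - 1) := by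
  -- This choice of `k` truncates the left side to `(0, r]` and the inner integral to `(0, min t
  -- r]`.
  have h := lintegral_mul_tailDensity (q := q) hv (k := (Iic r).indicator 1)
    (measurable_one.indicator measurableSet_Iic).aemeasurable
  have hind : ∀ (g : ℝ → ℝ≥0∞) (s : ℝ), (Iic r).indicator 1 s * g s = (Iic r).indicator g s := by
    intro g s
    by_cases hs : s ∈ Iic r <;> simp [hs]
  simp only [hind (tailDensity q v), hind fun s => ENNReal.ofReal s ^ (q - 1)] at h
  rw [lintegral_indicator measurableSet_Iic, Measure.restrict_restrict measurableSet_Iic,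
    inter_comm, Ioi_inter_Iic] at h
  rw [h]
  refine lintegral_congr fun t => ?_
  rw [lintegral_indicator measurableSet_Iic, Measure.restrict_restrict measurableSet_Iic,
    inter_comm, Ioc_inter_Iic]

theorem lintegral_tailDensity_le {q : ℝ} (hq : 1 < q) {v : ℝ → ℝ≥0}
    (hv : AEMeasurable v (volume.restrict (Ioi 0))) {r : ℝ} (hr : 0 < r) :
    ∫⁻ s in Ioc 0 r, tailDensity q v s ≤ fundamental q v r := by
  rw [lintegral_tailDensity hv, fundamental_eq (by linarith) hr]
  gcongr
  exact lintegral_rpow_sub_one_le hq _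

theorem fundamental_le {q : ℝ} (hq : 1 < q) {v : ℝ → ℝ≥0}
    (hv : AEMeasurable v (volume.restrict (Ioi 0))) {r : ℝ} (hr : 0 < r) :
    fundamental q v r ≤ 2 ^ q * ∫⁻ s in Ioc 0 r, tailDensity q v s := by
  rw [lintegral_tailDensity hv, fundamental_eq (by linarith) hr,
    ← lintegral_const_mul' _ _ (ENNReal.rpow_ne_top_of_nonneg (by linarith) ENNReal.ofNat_ne_top)]
  refine setLIntegral_mono' measurableSet_Ioi fun t ht => ?_
  rw [mul_left_comm]
  gcongr
  exact rpow_le_lintegral_rpow_sub_one hq (lt_min ht hr)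

/-! ### The fundamental function controls the norm -/

/-- The `q`-th power of the norm of `Γ^q(v)`. -/
noncomputable def gammaIntegral {n : ℕ} (q : ℝ) (v : ℝ → ℝ≥0)
    (f : EuclideanSpace ℝ (Fin n) → ℝ≥0) : ℝ≥0∞ :=
  ∫⁻ t in Ioi (0 : ℝ), maximalFunction f t ^ q * (v t : ℝ≥0∞)

theorem ofReal_mul_maximalFunction {n : ℕ} (f : EuclideanSpace ℝ (Fin n) → ℝ≥0) {t : ℝ}
    (ht : 0 < t) :
    ENNReal.ofReal t * maximalFunction f t = ∫⁻ s in Ioc 0 t, rearrangement f s := by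
  rw [maximalFunction, ← mul_assoc, ENNReal.mul_inv_cancel (by simpa using ht)
    ENNReal.ofReal_ne_top, one_mul]

theorem maximalFunction_antitoneOn {n : ℕ} (f : EuclideanSpace ℝ (Fin n) → ℝ≥0) :
    AntitoneOn (maximalFunction f) (Ioi 0) :=
  average_antitoneOn ((rearrangement_antitone f).antitoneOn _)

/-- A decreasing function equivalent to the density of `(t f^{**}(t))^q` with respect to
`t^(q-1) dt`. -/
noncomputable def powerDensity {n : ℕ} (q : ℝ) (f : EuclideanSpace ℝ (Fin n) → ℝ≥0) (s : ℝ) :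
    ℝ≥0∞ :=
  maximalFunction f s ^ (q - 1) * rearrangement f s

theorem powerDensity_antitoneOn {n : ℕ} {q : ℝ} (hq : 1 < q)
    (f : EuclideanSpace ℝ (Fin n) → ℝ≥0) : AntitoneOn (powerDensity q f) (Ioi 0) := by
  intro s hs t ht hst
  have h : 0 ≤ q - 1 := by linarith
  exact mul_le_mul' (ENNReal.rpow_le_rpow (maximalFunction_antitoneOn f hs ht hst) h)
    (rearrangement_antitone f hst)

theorem lintegral_powerDensity {n : ℕ} {q : ℝ} (hq : 1 < q)
    (f : EuclideanSpace ℝ (Fin n) → ℝ≥0) (t : ℝ) :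
    ∫⁻ s in Ioc 0 t, powerDensity q f s * ENNReal.ofReal s ^ (q - 1) =
      ∫⁻ s in Ioc 0 t, (∫⁻ x in Ioc 0 s, rearrangement f x) ^ (q - 1) * rearrangement f s := by
  refine setLIntegral_congr_fun measurableSet_Ioc fun s hs => ?_
  rw [← ofReal_mul_maximalFunction f hs.1, ENNReal.mul_rpow_of_nonneg _ _ (by linarith),
    powerDensity]
  ring

theorem maximalFunction_rpow_mul {n : ℕ} {q : ℝ} (hq : 0 < q)
    (f : EuclideanSpace ℝ (Fin n) → ℝ≥0) (t : ℝ) (a : ℝ≥0∞) :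
    maximalFunction f t ^ q * a =
      a / ENNReal.ofReal t ^ q * (∫⁻ s in Ioc 0 t, rearrangement f s) ^ q := by
  rw [maximalFunction, ENNReal.mul_rpow_of_nonneg _ _ hq.le, ENNReal.inv_rpow, div_eq_mul_inv]
  ring

/-- Bounding `(∫_0^t f^*)^q` for each `t` and applying Tonelli replaces the norm by a pairing of a
decreasing function with a density, the setting of Hardy's lemma. -/
theorem gammaIntegral_le_tail {n : ℕ} {q : ℝ} (hq : 1 < q) {v : ℝ → ℝ≥0}
    (hv : AEMeasurable v (volume.restrict (Ioi 0))) (f : EuclideanSpace ℝ (Fin n) → ℝ≥0) :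
    gammaIntegral q v f ≤ 2 ^ q * ∫⁻ s in Ioi 0, powerDensity q f s * tailDensity q v s := by
  rw [lintegral_mul_tailDensity hv (aemeasurable_restrict_of_antitoneOn measurableSet_Ioi
    (powerDensity_antitoneOn hq f)), gammaIntegral,
    ← lintegral_const_mul' _ _ (ENNReal.rpow_ne_top_of_nonneg (by linarith) ENNReal.ofNat_ne_top)]
  refine setLIntegral_mono' measurableSet_Ioi fun t ht => ?_
  rw [maximalFunction_rpow_mul (by linarith) f t, lintegral_powerDensity hq, mul_left_comm]
  gcongr
  exact primitive_rpow_le ((rearrangement_antitone f).antitoneOn _) hq ht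

theorem tail_le_gammaIntegral {n : ℕ} {q : ℝ} (hq : 1 < q) {v : ℝ → ℝ≥0}
    (hv : AEMeasurable v (volume.restrict (Ioi 0))) (f : EuclideanSpace ℝ (Fin n) → ℝ≥0) :
    ∫⁻ s in Ioi 0, powerDensity q f s * tailDensity q v s ≤ gammaIntegral q v f := by
  rw [lintegral_mul_tailDensity hv (aemeasurable_restrict_of_antitoneOn measurableSet_Ioi
    (powerDensity_antitoneOn hq f)), gammaIntegral]
  refine setLIntegral_mono' measurableSet_Ioi fun t ht => ?_
  rw [maximalFunction_rpow_mul (by linarith) f t, lintegral_powerDensity hq]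
  gcongr
  exact lintegral_primitive_rpow_mul_le ((rearrangement_antitone f).antitoneOn _) hq t

/-- Domination of the fundamental functions gives domination of the norms. -/
theorem gammaIntegral_le_of_fundamental_le {n : ℕ} {q : ℝ} (hq : 1 < q) {u v : ℝ → ℝ≥0}
    (hu : AEMeasurable u (volume.restrict (Ioi 0)))
    (hv : AEMeasurable v (volume.restrict (Ioi 0))) {C : ℝ≥0∞} (hC : C ≠ ∞)
    (h : ∀ r : ℝ, 0 < r → fundamental q v r ≤ C * fundamental q u r)
    (f : EuclideanSpace ℝ (Fin n) → ℝ≥0) :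
    gammaIntegral q v f ≤ 2 ^ q * (C * 2 ^ q) * gammaIntegral q u f := by
  have h2 : (2 : ℝ≥0∞) ^ q ≠ ∞ := ENNReal.rpow_ne_top_of_nonneg (by linarith) ENNReal.ofNat_ne_top
  have hmeas : ∀ r : ℝ, 0 < r → volume.withDensity (tailDensity q v) (Ioc 0 r) ≤
      C * 2 ^ q * volume.withDensity (tailDensity q u) (Ioc 0 r) := by
    intro r hr
    rw [withDensity_apply _ measurableSet_Ioc, withDensity_apply _ measurableSet_Ioc, mul_assoc]
    refine (lintegral_tailDensity_le hq hv hr).trans ((h r hr).trans ?_)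
    gcongr
    exact fundamental_le hq hu hr
  have hcov : ∀ z : ℝ → ℝ≥0,
      ∫⁻ s in Ioi 0, powerDensity q f s ∂(volume.withDensity (tailDensity q z)) =
        ∫⁻ s in Ioi 0, powerDensity q f s * tailDensity q z s := by
    intro z
    rw [restrict_withDensity measurableSet_Ioi,
      lintegral_withDensity_eq_lintegral_mul₀ (measurable_tailDensity q z).aemeasurable
        (aemeasurable_restrict_of_antitoneOn measurableSet_Ioi (powerDensity_antitoneOn hq f))]
    exact lintegral_congr fun s => mul_comm _ _
  -- Hardy's lemma for the measures with densities `tailDensity`: their masses on `(0, r]` are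
  -- comparable to the fundamental functions.
  have key := lintegral_le_of_antitoneOn (ENNReal.mul_ne_top hC h2) hmeas
    (powerDensity_antitoneOn hq f)
  rw [hcov, hcov] at key
  refine (gammaIntegral_le_tail hq hv f).trans ?_
  rw [mul_assoc]
  gcongr
  refine key.trans ?_
  gcongr
  exact tail_le_gammaIntegral hq hu f

/-! ### One-sided bounds and equivalence -/

theorem equivalentOn_of_le {ι : Type*} {S : Set ι} {A B : ι → ℝ≥0∞} {C D : ℝ≥0∞} (hC : C ≠ ∞)
    (hD : D ≠ ∞) (hAB : ∀ i ∈ S, A i ≤ C * B i) (hBA : ∀ i ∈ S, B i ≤ D * A i) :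
    EquivalentOn S A B := by
  lift C to ℝ≥0 using hC
  lift D to ℝ≥0 using hD
  have hC' : C ≤ max C D + 2 := (le_max_left _ _).trans le_self_add
  have hD' : D ≤ max C D + 2 := (le_max_right _ _).trans le_self_add
  -- The summand `2` secures a constant strictly above `1`.
  refine ⟨max C D + 2, ?_, fun i hi => ⟨?_, ?_⟩⟩
  · exact lt_of_lt_of_le one_lt_two le_add_self
  · rw [ENNReal.inv_mul_le_iff (by simp) ENNReal.coe_ne_top]
    exact (hAB i hi).trans (mul_le_mul_left (ENNReal.coe_le_coe.2 hC') _)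
  · exact (hBA i hi).trans (mul_le_mul_left (ENNReal.coe_le_coe.2 hD') _)

theorem EquivalentOn.exists_le {ι : Type*} {S : Set ι} {A B : ι → ℝ≥0∞}
    (h : EquivalentOn S A B) : ∃ C : ℝ≥0, 0 < C ∧ (∀ i ∈ S, A i ≤ C * B i) ∧
      ∀ i ∈ S, B i ≤ C * A i := by
  obtain ⟨C, hC, h⟩ := h
  refine ⟨C, zero_lt_one.trans hC, fun i hi => ?_, fun i hi => (h i hi).2⟩
  exact (ENNReal.inv_mul_le_iff (by simpa using (zero_lt_one.trans hC).ne')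
    ENNReal.coe_ne_top).1 (h i hi).1

/-! ### The weight `W^(q-1) w` and its association with `w` under `B_1` -/

/-- The weight `W^(q-1) w`. -/
noncomputable def powerWeight (q : ℝ) (w : ℝ → ℝ≥0) (t : ℝ) : ℝ≥0 :=
  (primitive w t ^ (q - 1) * (w t : ℝ≥0∞)).toNNReal

theorem primitive_ne_top {w : ℝ → ℝ≥0} (hw : IsWeight w) {t : ℝ} (ht : 0 < t) :
    primitive w t ≠ ∞ := (hw.2 t ht).ne

theorem primitive_mono (w : ℝ → ℝ≥0) : Monotone (primitive w) := fun _ _ h =>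
  lintegral_mono_set (Ioc_subset_Ioc_right h)

theorem coe_powerWeight {q : ℝ} (hq : 1 < q) {w : ℝ → ℝ≥0} (hw : IsWeight w) {t : ℝ}
    (ht : 0 < t) : (powerWeight q w t : ℝ≥0∞) = primitive w t ^ (q - 1) * (w t : ℝ≥0∞) :=
  ENNReal.coe_toNNReal (ENNReal.mul_ne_top (ENNReal.rpow_ne_top_of_nonneg (by linarith)
    (primitive_ne_top hw ht)) ENNReal.coe_ne_top)

theorem coe_antitoneOn {w : ℝ → ℝ≥0} (hdec : AntitoneOn w (Ioi 0)) :
    AntitoneOn (fun t => (w t : ℝ≥0∞)) (Ioi 0) := fun _ hx _ hy hxy =>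
  ENNReal.coe_le_coe.2 (hdec hx hy hxy)

theorem primitive_powerWeight {q : ℝ} (hq : 1 < q) {w : ℝ → ℝ≥0} (hw : IsWeight w) (t : ℝ) :
    primitive (powerWeight q w) t =
      ∫⁻ s in Ioc 0 t, (∫⁻ x in Ioc 0 s, (w x : ℝ≥0∞)) ^ (q - 1) * (w s : ℝ≥0∞) :=
  setLIntegral_congr_fun measurableSet_Ioc fun _ hs => coe_powerWeight hq hw hs.1

theorem primitive_powerWeight_le {q : ℝ} (hq : 1 < q) {w : ℝ → ℝ≥0} (hw : IsWeight w)
    (hdec : AntitoneOn w (Ioi 0)) (t : ℝ) :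
    primitive (powerWeight q w) t ≤ primitive w t ^ q := by
  rw [primitive_powerWeight hq hw]
  exact lintegral_primitive_rpow_mul_le (coe_antitoneOn hdec) hq t

theorem isWeight_powerWeight {q : ℝ} (hq : 1 < q) {w : ℝ → ℝ≥0} (hw : IsWeight w)
    (hdec : AntitoneOn w (Ioi 0)) : IsWeight (powerWeight q w) := by
  refine ⟨?_, fun t ht => (primitive_powerWeight_le hq hw hdec t).trans_lt
    (ENNReal.rpow_lt_top_of_nonneg (by linarith) (primitive_ne_top hw ht))⟩
  exact (((primitive_mono w).measurable.pow_const _).aemeasurable.mul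
    hw.1.coe_nnreal_ennreal).ennreal_toNNReal

/-- The average `W(t) / t`. -/
noncomputable def average (w : ℝ → ℝ≥0) (t : ℝ) : ℝ≥0∞ :=
  (ENNReal.ofReal t)⁻¹ * primitive w t

theorem ofReal_mul_average (w : ℝ → ℝ≥0) {t : ℝ} (ht : 0 < t) :
    ENNReal.ofReal t * average w t = primitive w t := by
  rw [average, ← mul_assoc, ENNReal.mul_inv_cancel (by simpa using ht)
    ENNReal.ofReal_ne_top, one_mul]

theorem average_ne_top {w : ℝ → ℝ≥0} (hw : IsWeight w) {t : ℝ} (ht : 0 < t) :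
    average w t ≠ ∞ :=
  ENNReal.mul_ne_top (by simpa using ht) (primitive_ne_top hw ht)

theorem average_weight_antitoneOn {w : ℝ → ℝ≥0} (hdec : AntitoneOn w (Ioi 0)) :
    AntitoneOn (average w) (Ioi 0) := average_antitoneOn (coe_antitoneOn hdec)

/-- Splitting `t^q = t^(q-1) t` isolates the `B_1` integrand `w(t) / t` beside a decreasing factor.
-/
theorem powerWeight_div {q : ℝ} (hq : 1 < q) {w : ℝ → ℝ≥0} (hw : IsWeight w) {t : ℝ}
    (ht : 0 < t) : (powerWeight q w t : ℝ≥0∞) / ENNReal.ofReal t ^ q =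
      average w t ^ (q - 1) * ((w t : ℝ≥0∞) / ENNReal.ofReal t) := by
  have h : ENNReal.ofReal t ^ q = ENNReal.ofReal t ^ (q - 1) * ENNReal.ofReal t := by
    conv_rhs => rw [← ENNReal.rpow_one (ENNReal.ofReal t), ← ENNReal.rpow_mul, one_mul]
    rw [← ENNReal.rpow_add_of_nonneg _ _ (by linarith) zero_le_one, sub_add_cancel]
  rw [coe_powerWeight hq hw ht, average, ENNReal.mul_rpow_of_nonneg _ _ (by linarith),
    ENNReal.inv_rpow, div_eq_mul_inv, div_eq_mul_inv, h,
    ENNReal.mul_inv (.inr ENNReal.ofReal_ne_top) (.inr (by simpa using ht))]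
  ring

theorem average_rpow {q : ℝ} (hq : 1 < q) (w : ℝ → ℝ≥0) {t : ℝ} (ht : 0 < t) :
    ENNReal.ofReal t ^ q * average w t ^ q = primitive w t ^ q := by
  rw [← ENNReal.mul_rpow_of_nonneg _ _ (by linarith), ofReal_mul_average w ht]

theorem rpow_sub_one_mul_self {q : ℝ} (hq : 1 < q) (a : ℝ≥0∞) : a ^ (q - 1) * a = a ^ q := by
  conv_lhs => rw [← ENNReal.rpow_one a, ← ENNReal.rpow_mul, one_mul]
  rw [← ENNReal.rpow_add_of_nonneg _ _ (by linarith) zero_le_one, sub_add_cancel]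

theorem memB_one_iff {w : ℝ → ℝ≥0} : MemB 1 w ↔ ∃ C : ℝ≥0, ∀ r : ℝ, 0 < r →
    ∫⁻ s in Ioi r, (w s : ℝ≥0∞) / ENNReal.ofReal s ≤ C * average w r := by
  simp only [MemB, ENNReal.rpow_one, average, div_eq_mul_inv, mul_assoc, primitive]

/-- For a decreasing weight in `B_1`, the weight `W^(q-1) w` is associated with `w` and `q`. -/
theorem isAssociatedWeight_powerWeight {q : ℝ} (hq : 1 < q) {w : ℝ → ℝ≥0} (hw : IsWeight w)
    (hdec : AntitoneOn w (Ioi 0)) (hB : MemB 1 w) :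
    IsAssociatedWeight q w (powerWeight q w) := by
  obtain ⟨C, hC⟩ := memB_one_iff.1 hB
  refine ⟨isWeight_powerWeight hq hw hdec, ?_⟩
  refine equivalentOn_of_le (C := 2 ^ q) (D := 1 + C)
    (ENNReal.rpow_ne_top_of_nonneg (by linarith) ENNReal.ofNat_ne_top) (by simp) ?_ ?_
  · intro r hr
    refine (primitive_rpow_le (coe_antitoneOn hdec) hq hr).trans ?_
    rw [← primitive_powerWeight hq hw]
    gcongr
    exact le_self_add
  · intro r hr
    rw [add_mul, one_mul]
    refine add_le_add (primitive_powerWeight_le hq hw hdec r) ?_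
    rw [← average_rpow hq w hr, mul_left_comm]
    gcongr
    -- For `x > r` the decreasing factor `(W(x)/x)^(q-1)` is bounded by its value at `r`, leaving
    -- the integral controlled by `B_1`.
    calc ∫⁻ x in Ioi r, (powerWeight q w x : ℝ≥0∞) / ENNReal.ofReal x ^ q
        ≤ ∫⁻ x in Ioi r, average w r ^ (q - 1) * ((w x : ℝ≥0∞) / ENNReal.ofReal x) := by
          refine setLIntegral_mono' measurableSet_Ioi fun x hx => ?_
          have hx0 : 0 < x := lt_trans hr hx
          rw [powerWeight_div hq hw hx0]
          gcongr
          exact average_weight_antitoneOn hdec hr hx0 (le_of_lt hx)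
      _ = average w r ^ (q - 1) * ∫⁻ x in Ioi r, (w x : ℝ≥0∞) / ENNReal.ofReal x :=
          lintegral_const_mul' _ _ (ENNReal.rpow_ne_top_of_nonneg (by linarith)
            (average_ne_top hw hr))
      _ ≤ average w r ^ (q - 1) * (C * average w r) := by gcongr; exact hC r hr
      _ = C * average w r ^ q := by rw [mul_left_comm, rpow_sub_one_mul_self hq]

theorem gammaNorm_self {n : ℕ} {q : ℝ} (hq : q ≠ 0) (v : ℝ → ℝ≥0)
    (f : EuclideanSpace ℝ (Fin n) → ℝ≥0) :
    gammaNorm q q v f = gammaIntegral q v f ^ (1 / q) := by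
  simp [gammaNorm, gammaIntegral, div_self hq]

/-- For `p = 1` the exponent `q/p - 1` equals `q - 1`, so `Γ^{1,q}(w)` is itself a space `Γ^q`. -/
theorem gammaNorm_one {n : ℕ} {q : ℝ} (hq : 1 < q) {w : ℝ → ℝ≥0} (hw : IsWeight w)
    (f : EuclideanSpace ℝ (Fin n) → ℝ≥0) :
    gammaNorm 1 q w f = gammaIntegral q (powerWeight q w) f ^ (1 / q) := by
  rw [gammaNorm, gammaIntegral]
  congr 1
  refine setLIntegral_congr_fun measurableSet_Ioi fun t ht => ?_
  simp only [div_one, coe_powerWeight hq hw ht, mul_assoc]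

/-! ### From a bound on the fundamental function to `B_1` -/

/-- Split `W(4a)` at `a`: the part up to `a` is diluted by the factor `4`, and `1/(4a) ≤ 1/x` on the
rest. -/
theorem average_step {w : ℝ → ℝ≥0} {a : ℝ} (ha : 0 < a) :
    average w (4 * a) ≤
      (∫⁻ x in Ioc a (4 * a), (w x : ℝ≥0∞) / ENNReal.ofReal x) + average w a / 4 := by
  have h4 : ENNReal.ofReal (4 * a) = 4 * ENNReal.ofReal a := by
    rw [ENNReal.ofReal_mul (by norm_num)]; norm_num
  have hsplit : primitive w (4 * a) = primitive w a + ∫⁻ x in Ioc a (4 * a), (w x : ℝ≥0∞) := by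
    rw [primitive, primitive, ← Ioc_union_Ioc_eq_Ioc ha.le (by linarith : a ≤ 4 * a),
      lintegral_union measurableSet_Ioc (Ioc_disjoint_Ioc_of_le le_rfl)]
  rw [average, hsplit, mul_add, add_comm]
  gcongr
  · rw [← lintegral_const_mul' _ _ (by simpa using ha)]
    refine setLIntegral_mono' measurableSet_Ioc fun x hx => ?_
    rw [mul_comm, ← div_eq_mul_inv]
    gcongr
    exact hx.2
  · rw [h4, average, ENNReal.mul_inv (by simp) (by simp), div_eq_mul_inv]
    exact le_of_eq (by ring)

/-- The diluted old mass accounts for at most `A/4` of the assumed `A/2`, where `A = W(r)/r`; the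
block must supply the other `A/4`. -/
theorem le_lintegral_of_half_lt {w : ℝ → ℝ≥0} (hw : IsWeight w) (hdec : AntitoneOn w (Ioi 0))
    {r a : ℝ} (hr : 0 < r) (hra : r ≤ a) (h : average w r / 2 ≤ average w (4 * a)) :
    average w r / 4 ≤ ∫⁻ x in Ioc a (4 * a), (w x : ℝ≥0∞) / ENNReal.ofReal x := by
  have ha : 0 < a := hr.trans_le hra
  have h1 : average w a / 4 ≤ average w r / 4 := by
    gcongr
    exact average_weight_antitoneOn hdec hr ha hra
  have h2 : average w r / 4 + average w r / 4 ≤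
      (∫⁻ x in Ioc a (4 * a), (w x : ℝ≥0∞) / ENNReal.ofReal x) + average w r / 4 := by
    calc average w r / 4 + average w r / 4 = average w r / 2 := by
          rw [← ENNReal.add_halves (average w r / 2)]
          simp only [div_eq_mul_inv, mul_assoc]
          rw [← ENNReal.mul_inv (by simp) (by simp)]
          norm_num
      _ ≤ _ := h.trans ((average_step ha).trans (by gcongr))
  exact (ENNReal.add_le_add_iff_right
    (ENNReal.div_ne_top (average_ne_top hw hr) (by norm_num))).1 h2

theorem nat_mul_le_lintegral {q : ℝ} (hq : 1 < q) {w : ℝ → ℝ≥0} (hw : IsWeight w)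
    (hdec : AntitoneOn w (Ioi 0)) {r : ℝ} (hr : 0 < r) (N : ℕ)
    (h : average w r / 2 ≤ average w (4 ^ N * r)) :
    N * ((average w r / 2) ^ (q - 1) * (average w r / 4)) ≤
      ∫⁻ x in Ioc r (4 ^ N * r), (powerWeight q w x : ℝ≥0∞) / ENNReal.ofReal x ^ q := by
  induction N with
  | zero => simp
  | succ N ih =>
    have hp : (1 : ℝ) ≤ 4 ^ N := one_le_pow₀ (by norm_num)
    have hrN : r ≤ 4 ^ N * r := le_mul_of_one_le_left hr.le hp
    have hN0 : 0 < 4 ^ N * r := hr.trans_le hrN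
    have hs : (4 : ℝ) ^ (N + 1) * r = 4 * (4 ^ N * r) := by ring
    have hle : 4 ^ N * r ≤ 4 * (4 ^ N * r) := by linarith
    rw [hs] at h ⊢
    have h' := h.trans (average_weight_antitoneOn hdec hN0 (hN0.trans_le hle) hle)
    rw [← Ioc_union_Ioc_eq_Ioc hrN hle,
      lintegral_union measurableSet_Ioc (Ioc_disjoint_Ioc_of_le le_rfl), Nat.cast_add, add_mul]
    refine add_le_add (ih h') ?_
    rw [Nat.cast_one, one_mul]
    calc (average w r / 2) ^ (q - 1) * (average w r / 4)
        ≤ (average w r / 2) ^ (q - 1) *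
          ∫⁻ x in Ioc (4 ^ N * r) (4 * (4 ^ N * r)), (w x : ℝ≥0∞) / ENNReal.ofReal x := by
          gcongr
          exact le_lintegral_of_half_lt hw hdec hr hrN h
      _ ≤ ∫⁻ x in Ioc (4 ^ N * r) (4 * (4 ^ N * r)),
          (average w r / 2) ^ (q - 1) * ((w x : ℝ≥0∞) / ENNReal.ofReal x) :=
          lintegral_const_mul_le _ _
      _ ≤ _ := by
          refine setLIntegral_mono' measurableSet_Ioc fun x hx => ?_
          have hx0 := hN0.trans hx.1
          rw [powerWeight_div hq hw hx0]
          gcongr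
          exact h.trans (average_weight_antitoneOn hdec hx0 (hN0.trans_le hle) hx.2)

theorem exists_average_le_half {q : ℝ} (hq : 1 < q) {w : ℝ → ℝ≥0} (hw : IsWeight w)
    (hdec : AntitoneOn w (Ioi 0)) {K : ℝ≥0∞} (hK : K ≠ ∞)
    (h : ∀ r : ℝ, 0 < r → ∫⁻ x in Ioi r, (powerWeight q w x : ℝ≥0∞) / ENNReal.ofReal x ^ q ≤
      K * average w r ^ q) :
    ∃ N : ℕ, ∀ r : ℝ, 0 < r → average w (4 ^ N * r) ≤ average w r / 2 := by
  have hq0 : 0 < q := by linarith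
  -- If the average has not halved by `4^N r`, the blocks give `N (A/2)^q / 2 ≤ K A^q = K 2^q
  -- (A/2)^q`, so any `N > 2 * 2^q * K` is contradictory, uniformly in `r`.
  have hfin : K * (2 * 2 ^ q) ≠ ∞ := by
    have : (2 : ℝ≥0∞) ^ q ≠ ∞ := ENNReal.rpow_ne_top_of_nonneg hq0.le ENNReal.ofNat_ne_top
    exact ENNReal.mul_ne_top hK (ENNReal.mul_ne_top ENNReal.ofNat_ne_top this)
  obtain ⟨N, hN⟩ := ENNReal.exists_nat_gt hfin
  refine ⟨N, fun r hr => ?_⟩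
  by_contra! hlt
  have h1 := (nat_mul_le_lintegral hq hw hdec hr N hlt.le).trans
    ((lintegral_mono_set Ioc_subset_Ioi_self).trans (h r hr))
  set A := average w r with hA
  have hAtop : A ≠ ∞ := average_ne_top hw hr
  have hA0 : A ≠ 0 := by
    have hp : (1 : ℝ) ≤ 4 ^ N := one_le_pow₀ (by norm_num)
    have hrN : r ≤ 4 ^ N * r := le_mul_of_one_le_left hr.le hp
    have := hlt.trans_le (average_weight_antitoneOn hdec hr (hr.trans_le hrN) hrN)
    rw [← hA] at this
    rintro h0
    simp [h0] at this
  set a := (A / 2) ^ q with ha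
  have ha0 : a ≠ 0 := by
    simp [ha, hq0.not_gt, hA0]
  have hatop : a ≠ ∞ := ENNReal.rpow_ne_top_of_nonneg hq0.le (ENNReal.div_ne_top hAtop two_ne_zero)
  have hA2 : A ^ q = 2 ^ q * a := by
    rw [ha, ← ENNReal.mul_rpow_of_nonneg _ _ hq0.le,
      ENNReal.mul_div_cancel two_ne_zero ENNReal.ofNat_ne_top]
  have h4 : A / 2 = 2 * (A / 4) := by
    rw [show (4 : ℝ≥0∞) = 2 * 2 by norm_num, div_eq_mul_inv, div_eq_mul_inv,
      ENNReal.mul_inv (by simp) (by simp)]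
    rw [show 2 * (A * ((2 : ℝ≥0∞)⁻¹ * 2⁻¹)) = (2 * 2⁻¹) * (A * 2⁻¹) by ring,
      ENNReal.mul_inv_cancel two_ne_zero ENNReal.ofNat_ne_top, one_mul]
  have h2 : N * a ≤ (K * (2 * 2 ^ q)) * a := by
    calc N * a = 2 * (N * ((A / 2) ^ (q - 1) * (A / 4))) := by
          rw [ha, ← rpow_sub_one_mul_self hq (A / 2)]
          conv_lhs => enter [2, 2]; rw [h4]
          ring
      _ ≤ 2 * (K * A ^ q) := by gcongr
      _ = _ := by rw [hA2]; ring
  exact absurd hN (not_lt.2 ((ENNReal.mul_le_mul_iff_left ha0 hatop).1 h2))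

/-- On `(r, L r]` the integrand is at most `A/r`, with `A = W(r)/r`, contributing at most `L A`.
Restarting at `L r` halves the average, and the constant closes because `L + 2L/2 = 2L`. -/
theorem lintegral_Ioc_div_le {w : ℝ → ℝ≥0} (hdec : AntitoneOn w (Ioi 0)) {L : ℝ} (hL : 1 ≤ L)
    (h : ∀ r : ℝ, 0 < r → average w (L * r) ≤ average w r / 2) (N : ℕ) {r : ℝ} (hr : 0 < r) :
    ∫⁻ x in Ioc r (L ^ N * r), (w x : ℝ≥0∞) / ENNReal.ofReal x ≤
      2 * ENNReal.ofReal L * average w r := by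
  induction N generalizing r with
  | zero => simp
  | succ N ih =>
    have h1 : r ≤ L * r := le_mul_of_one_le_left hr.le hL
    have hLr : 0 < L * r := hr.trans_le h1
    have h2 : L * r ≤ L ^ N * (L * r) := le_mul_of_one_le_left hLr.le (one_le_pow₀ hL)
    rw [pow_succ, mul_assoc, ← Ioc_union_Ioc_eq_Ioc h1 h2,
      lintegral_union measurableSet_Ioc (Ioc_disjoint_Ioc_of_le le_rfl)]
    have hfirst : ∫⁻ x in Ioc r (L * r), (w x : ℝ≥0∞) / ENNReal.ofReal x ≤
        ENNReal.ofReal L * average w r := by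
      calc ∫⁻ x in Ioc r (L * r), (w x : ℝ≥0∞) / ENNReal.ofReal x
          ≤ ∫⁻ x in Ioc r (L * r), average w r / ENNReal.ofReal r := by
            refine setLIntegral_mono' measurableSet_Ioc fun x hx => ?_
            gcongr
            · exact (coe_antitoneOn hdec hr (hr.trans hx.1) hx.1.le).trans
                (le_average (coe_antitoneOn hdec) hr)
            · exact hx.1.le
        _ = average w r / ENNReal.ofReal r * ENNReal.ofReal (L * r - r) := by
            rw [setLIntegral_const, Real.volume_Ioc]
        _ ≤ average w r / ENNReal.ofReal r * (ENNReal.ofReal r * ENNReal.ofReal L) := by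
            rw [← ENNReal.ofReal_mul hr.le]
            gcongr
            nlinarith
        _ = _ := by
            rw [← mul_assoc, ENNReal.div_mul_cancel (by simpa using hr) ENNReal.ofReal_ne_top,
              mul_comm]
    calc _ ≤ ENNReal.ofReal L * average w r + 2 * ENNReal.ofReal L * (average w r / 2) :=
          add_le_add hfirst ((ih hLr).trans (by gcongr; exact h r hr))
      _ = _ := by
          rw [show 2 * ENNReal.ofReal L * (average w r / 2) =
            ENNReal.ofReal L * (2 * (average w r / 2)) by ring,
            ENNReal.mul_div_cancel two_ne_zero ENNReal.ofNat_ne_top]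
          ring

theorem memB_one_of_average_le_half {w : ℝ → ℝ≥0} (hdec : AntitoneOn w (Ioi 0)) {L : ℝ}
    (hL : 1 < L) (h : ∀ r : ℝ, 0 < r → average w (L * r) ≤ average w r / 2) : MemB 1 w := by
  refine memB_one_iff.2 ⟨2 * L.toNNReal, fun r hr => ?_⟩
  have hU : Ioi r = ⋃ N : ℕ, Ioc r (L ^ N * r) := by
    ext x
    simp only [mem_Ioi, mem_iUnion, mem_Ioc, exists_and_left, iff_self_and]
    intro _
    obtain ⟨N, hN⟩ := pow_unbounded_of_one_lt (x / r) hL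
    exact ⟨N, ((div_lt_iff₀ hr).1 hN).le⟩
  have hmono : Monotone fun N : ℕ => Ioc r (L ^ N * r) := fun m n hmn => by
    refine Ioc_subset_Ioc_right (mul_le_mul_of_nonneg_right ?_ hr.le)
    exact pow_le_pow_right₀ hL.le hmn
  rw [hU, setLIntegral_iUnion_of_directed _ hmono.directed_le]
  exact iSup_le fun N => by
    simpa [ENNReal.ofReal] using lintegral_Ioc_div_le hdec hL.le h N hr

/-- If the fundamental function of `W^(q-1) w` is dominated by `W^q`, then `w` is in `B_1`. -/
theorem memB_one_of_fundamental_le {q : ℝ} (hq : 1 < q) {w : ℝ → ℝ≥0} (hw : IsWeight w)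
    (hdec : AntitoneOn w (Ioi 0)) {K : ℝ≥0∞} (hK : K ≠ ∞)
    (h : ∀ r : ℝ, 0 < r → fundamental q (powerWeight q w) r ≤ K * primitive w r ^ q) :
    MemB 1 w := by
  obtain ⟨N, hN⟩ := exists_average_le_half hq hw hdec hK fun r hr => by
    have h1 := le_trans le_add_self (h r hr)
    rw [← average_rpow hq w hr, mul_left_comm] at h1
    have hr0 : 0 < ENNReal.ofReal r := by simpa using hr
    refine (ENNReal.mul_le_mul_iff_right ?_ ?_).1 h1
    · exact (ENNReal.rpow_pos hr0 ENNReal.ofReal_ne_top).ne'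
    · exact ENNReal.rpow_ne_top_of_nonneg (by linarith) ENNReal.ofReal_ne_top
  -- The exponent is `N + 1` because `N` may be `0` while the dilation factor must exceed `1`.
  refine memB_one_of_average_le_half hdec (L := 4 ^ (N + 1))
    (one_lt_pow₀ (by norm_num) (by simp)) fun r hr => ?_
  refine (average_weight_antitoneOn hdec ?_ ?_ ?_).trans (hN r hr)
  · exact mem_Ioi.2 (by positivity)
  · exact mem_Ioi.2 (by positivity)
  · have : (0 : ℝ) < 4 ^ N * r := by positivity
    rw [pow_succ]
    linarith

/-! ### Test functions and the consequence of an inclusion -/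

/-- Each `d k` is at most the `ℓ^q` norm of `d`, and the weights `2^(-k)` sum to `2`. -/
theorem tsum_half_pow_mul_rpow_le {q : ℝ} (hq : 0 < q) (d : ℕ → ℝ≥0∞) :
    (∑' k, 2⁻¹ ^ k * d k) ^ q ≤ 2 ^ q * ∑' k, d k ^ q := by
  have h : ∑' k, 2⁻¹ ^ k * d k ≤ 2 * (∑' k, d k ^ q) ^ (1 / q) := by
    have h1 : ∑' k : ℕ, (2⁻¹ : ℝ≥0∞) ^ k = 2 := by
      rw [ENNReal.tsum_geometric, ENNReal.one_sub_inv_two, inv_inv]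
    refine le_trans ?_ (ENNReal.tsum_mul_right.trans (congrArg (· * _) h1)).le
    refine ENNReal.tsum_le_tsum fun k => mul_le_mul_right ?_ _
    rw [one_div, ENNReal.le_rpow_inv_iff hq]
    exact ENNReal.le_tsum k
  calc _ ≤ (2 * (∑' k, d k ^ q) ^ (1 / q)) ^ q := by gcongr
    _ = _ := by
      rw [ENNReal.mul_rpow_of_nonneg _ _ hq.le, ← ENNReal.rpow_mul, one_div_mul_cancel hq.ne',
        ENNReal.rpow_one]

/-- Monotonicity: `F` dominates `c` times the characteristic function of `(0, r)`. -/
theorem rpow_mul_fundamental_le {q : ℝ} (hq : 0 < q) (v : ℝ → ℝ≥0) {F : ℝ → ℝ≥0∞} {c : ℝ≥0∞}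
    {r : ℝ} (hr : 0 < r) (h : ∀ s, 0 < s → s < r → c ≤ F s) :
    c ^ q * fundamental q v r ≤
      ∫⁻ t in Ioi 0, (v t : ℝ≥0∞) / ENNReal.ofReal t ^ q * (∫⁻ s in Ioc 0 t, F s) ^ q := by
  rw [fundamental_eq hq hr]
  refine (lintegral_const_mul_le _ _).trans ?_
  refine setLIntegral_mono' measurableSet_Ioi fun t _ => ?_
  rw [mul_left_comm, ← ENNReal.mul_rpow_of_nonneg _ _ hq.le]
  gcongr
  calc c * ENNReal.ofReal (min t r) = ∫⁻ s in Ioo 0 (min t r), c := by simp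
    _ ≤ ∫⁻ s in Ioo 0 (min t r), F s := setLIntegral_mono' measurableSet_Ioo fun s hs =>
        h s hs.1 (hs.2.trans_le (min_le_right _ _))
    _ ≤ _ := lintegral_mono_set
        (Ioo_subset_Ioc_self.trans (Ioc_subset_Ioc_right (min_le_left _ _)))

/-- A superposition of characteristic functions of intervals `(0, r_k)`. -/
noncomputable def stepSum (c : ℕ → ℝ≥0∞) (r : ℕ → ℝ) (t : ℝ) : ℝ≥0∞ :=
  ∑' k, (Iio (r k)).indicator (fun _ => c k) t

theorem stepSum_antitone (c : ℕ → ℝ≥0∞) (r : ℕ → ℝ) : Antitone (stepSum c r) := by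
  intro s t hst
  refine ENNReal.tsum_le_tsum fun k => ?_
  by_cases ht : t ∈ Iio (r k)
  · have hs : s ∈ Iio (r k) := lt_of_le_of_lt hst ht
    simp [ht, hs]
  · simp [ht]

theorem le_stepSum (c : ℕ → ℝ≥0∞) (r : ℕ → ℝ) {k : ℕ} {t : ℝ} (ht : t < r k) :
    c k ≤ stepSum c r t := by
  refine le_trans ?_ (ENNReal.le_tsum k)
  simp [ht]

theorem lintegral_stepSum_le (c : ℕ → ℝ≥0∞) (r : ℕ → ℝ) (t : ℝ) :
    ∫⁻ s in Ioc 0 t, stepSum c r s ≤ ∑' k, c k * ENNReal.ofReal (min t (r k)) := by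
  simp only [stepSum]
  rw [lintegral_tsum fun k => (measurable_const.indicator measurableSet_Iio).aemeasurable]
  refine ENNReal.tsum_le_tsum fun k => ?_
  rw [lintegral_indicator measurableSet_Iio, Measure.restrict_restrict measurableSet_Iio,
    setLIntegral_const]
  gcongr
  calc volume (Iio (r k) ∩ Ioc 0 t) ≤ volume (Ioc 0 (min t (r k))) :=
        measure_mono fun s hs => ⟨hs.2.1, le_min hs.2.2 (le_of_lt hs.1)⟩
    _ = _ := by rw [Real.volume_Ioc, sub_zero]

theorem lintegral_stepSum_rpow_le {q : ℝ} (hq : 0 < q) {v : ℝ → ℝ≥0}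
    (hv : AEMeasurable v (volume.restrict (Ioi 0))) (e : ℕ → ℝ≥0∞) (he : ∀ k, e k ≠ ∞)
    {r : ℕ → ℝ} (hr : ∀ k, 0 < r k) :
    ∫⁻ t in Ioi 0, (v t : ℝ≥0∞) / ENNReal.ofReal t ^ q *
        (∫⁻ s in Ioc 0 t, stepSum (fun k => 2⁻¹ ^ k * e k) r s) ^ q ≤
      2 ^ q * ∑' k, e k ^ q * fundamental q v (r k) := by
  have h2 : (2 : ℝ≥0∞) ^ q ≠ ∞ := ENNReal.rpow_ne_top_of_nonneg hq.le ENNReal.ofNat_ne_top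
  calc _ ≤ ∫⁻ t in Ioi 0, 2 ^ q * ∑' k, e k ^ q *
        ((v t : ℝ≥0∞) / ENNReal.ofReal t ^ q * ENNReal.ofReal (min t (r k)) ^ q) := by
        refine lintegral_mono fun t => ?_
        simp only
        have h1 : (∫⁻ s in Ioc 0 t, stepSum (fun k => 2⁻¹ ^ k * e k) r s) ^ q ≤
            2 ^ q * ∑' k, (e k * ENNReal.ofReal (min t (r k))) ^ q := by
          refine le_trans ?_ (tsum_half_pow_mul_rpow_le hq _)
          gcongr
          simpa only [mul_assoc] using lintegral_stepSum_le (fun k => 2⁻¹ ^ k * e k) r t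
        refine (mul_le_mul_right h1 _).trans_eq ?_
        rw [mul_left_comm, ← ENNReal.tsum_mul_left]
        congr 2
        funext k
        rw [ENNReal.mul_rpow_of_nonneg _ _ hq.le]
        ring
    _ = 2 ^ q * ∑' k, e k ^ q * fundamental q v (r k) := by
        have hm : ∀ k, AEMeasurable (fun t => (v t : ℝ≥0∞) / ENNReal.ofReal t ^ q *
            ENNReal.ofReal (min t (r k)) ^ q) (volume.restrict (Ioi 0)) := fun k => by fun_prop
        rw [lintegral_const_mul' _ _ h2, lintegral_tsum fun k => (hm k).const_mul _]
        congr 2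
        funext k
        rw [lintegral_const_mul' _ _ (ENNReal.rpow_ne_top_of_nonneg hq.le (he k)),
          fundamental_eq hq (hr k)]

/-- The measure of the ball centred at the origin with boundary through `x`. -/
noncomputable def ballMeasure {n : ℕ} (x : EuclideanSpace ℝ (Fin n)) : ℝ :=
  (volume (Metric.ball (0 : EuclideanSpace ℝ (Fin n)) 1)).toReal * ‖x‖ ^ n

theorem unitBall_toReal_pos (n : ℕ) :
    0 < (volume (Metric.ball (0 : EuclideanSpace ℝ (Fin n)) 1)).toReal :=
  ENNReal.toReal_pos (Metric.measure_ball_pos _ _ one_pos).ne' measure_ball_lt_top.ne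

/-- This makes `ballMeasure` transport volume to Lebesgue measure on the half-line, so a radial
function can have a prescribed rearrangement. -/
theorem volume_ballMeasure_lt {n : ℕ} (hn : 1 ≤ n) {t : ℝ} (ht : 0 < t) :
    volume {x : EuclideanSpace ℝ (Fin n) | ballMeasure x < t} = ENNReal.ofReal t := by
  set κ := (volume (Metric.ball (0 : EuclideanSpace ℝ (Fin n)) 1)).toReal with hκ
  have hκ0 : 0 < κ := unitBall_toReal_pos n
  have hn0 : n ≠ 0 := by omega
  set ρ := (t / κ) ^ (1 / (n : ℝ)) with hρ
  have hρ0 : 0 < ρ := Real.rpow_pos_of_pos (div_pos ht hκ0) _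
  have hρn : ρ ^ n = t / κ := by
    rw [hρ, one_div, Real.rpow_inv_natCast_pow (div_pos ht hκ0).le hn0]
  have hset : {x : EuclideanSpace ℝ (Fin n) | ballMeasure x < t} = Metric.ball 0 ρ := by
    ext x
    rw [mem_ofPred_eq, ballMeasure, ← hκ, mem_ball_zero_iff, mul_comm, ← lt_div_iff₀ hκ0, ← hρn,
      pow_lt_pow_iff_left₀ (norm_nonneg _) hρ0.le hn0]
  rw [hset, Measure.addHaar_ball_of_pos _ _ hρ0, finrank_euclideanSpace_fin, hρn,
    ← ENNReal.ofReal_toReal (measure_ball_lt_top (x := (0 : EuclideanSpace ℝ (Fin n)))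
      (r := 1)).ne, ← hκ, ← ENNReal.ofReal_mul (div_pos ht hκ0).le, div_mul_cancel₀ _ hκ0.ne']

/-- The radial function on `ℝⁿ` with profile `F`. -/
noncomputable def radial (n : ℕ) (F : ℝ → ℝ≥0∞) (x : EuclideanSpace ℝ (Fin n)) : ℝ≥0 :=
  (F (ballMeasure x)).toNNReal

theorem measurable_radial (n : ℕ) {F : ℝ → ℝ≥0∞} (hF : Antitone F) : Measurable (radial n F) := by
  refine (hF.measurable.comp ?_).ennreal_toNNReal
  exact measurable_const.mul (measurable_norm.pow_const n)

theorem rearrangement_radial_le {n : ℕ} (hn : 1 ≤ n) {F : ℝ → ℝ≥0∞} (hF : Antitone F) {t : ℝ}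
    (ht : 0 < t) : rearrangement (radial n F) t ≤ F t := by
  refine sInf_le ?_
  rw [mem_ofPred_eq, ← volume_ballMeasure_lt hn ht]
  refine measure_mono fun x hx => ?_
  by_contra hlt
  exact absurd hx (not_lt.2 (ENNReal.coe_toNNReal_le_self.trans (hF (not_lt.1 hlt))))

theorem le_rearrangement_radial {n : ℕ} (hn : 1 ≤ n) {F : ℝ → ℝ≥0∞}
    (hfin : ∀ t, 0 < t → F t ≠ ∞) {c : ℝ≥0∞} {r : ℝ} (hc : ∀ s, 0 < s → s < r → c ≤ F s) {t : ℝ}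
    (ht : 0 < t) (htr : t < r) : c ≤ rearrangement (radial n F) t := by
  have : NeZero n := ⟨by omega⟩
  refine le_sInf fun l hl => ?_
  by_contra! hlc
  -- The origin is removed because `F 0` may be infinite, and `toNNReal` would send it to `0`; a
  -- point is null since `n ≥ 1`.
  have hsub : {x : EuclideanSpace ℝ (Fin n) | ballMeasure x < r} \ {0} ⊆
      {x | l < (radial n F x : ℝ≥0∞)} := by
    rintro x ⟨hx, hx0⟩
    have hpos : 0 < ballMeasure x := mul_pos (unitBall_toReal_pos n)
      (pow_pos (norm_pos_iff.2 hx0) n)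
    rw [mem_ofPred_eq, radial, ENNReal.coe_toNNReal (hfin _ hpos)]
    exact hlc.trans_le (hc _ hpos hx)
  have h := (measure_mono hsub).trans hl
  rw [measure_sdiff_null (measure_singleton _), volume_ballMeasure_lt hn (ht.trans htr)] at h
  exact absurd htr (not_lt.2 ((ENNReal.ofReal_le_ofReal_iff ht.le).1 h))

theorem gammaIntegral_eq {n : ℕ} {q : ℝ} (hq : 0 < q) (v : ℝ → ℝ≥0)
    (f : EuclideanSpace ℝ (Fin n) → ℝ≥0) :
    gammaIntegral q v f = ∫⁻ t in Ioi 0, (v t : ℝ≥0∞) / ENNReal.ofReal t ^ q *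
      (∫⁻ s in Ioc 0 t, rearrangement f s) ^ q :=
  lintegral_congr fun t => maximalFunction_rpow_mul hq f t _

/-- An inclusion of spaces `Γ^q(v) ⊆ Γ^q(u)` forces a domination of fundamental functions. -/
theorem fundamental_le_of_subset {n : ℕ} (hn : 1 ≤ n) {q : ℝ} (hq : 0 < q) {u v : ℝ → ℝ≥0}
    (hv : AEMeasurable v (volume.restrict (Ioi 0)))
    (hv0 : ∀ r : ℝ, 0 < r → fundamental q v r ≠ 0) (hvt : ∀ r : ℝ, 0 < r → fundamental q v r ≠ ∞)
    (hsub : ∀ f : EuclideanSpace ℝ (Fin n) → ℝ≥0, Measurable f → gammaIntegral q v f < ∞ →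
      gammaIntegral q u f < ∞) :
    ∃ K : ℝ≥0∞, K ≠ ∞ ∧ ∀ r : ℝ, 0 < r → fundamental q u r ≤ K * fundamental q v r := by
  by_contra! hcon
  -- The factor `(2^k)^q` offsets the weight `2^(-k)` in `c k`, one `2^k` offsets `e k ^ q * φ_v(r
  -- k) = 2^(-k)`, and the other makes the norm for `u` blow up.
  have hKtop : ∀ k : ℕ, ((2 : ℝ≥0∞) ^ k) ^ q * (2 ^ k * 2 ^ k) ≠ ∞ := fun k =>
    ENNReal.mul_ne_top (ENNReal.rpow_ne_top_of_nonneg hq.le (by simp))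
      (ENNReal.mul_ne_top (by simp) (by simp))
  choose r hr hlt using fun k : ℕ => hcon _ (hKtop k)
  have h2k : ∀ k : ℕ, (2⁻¹ : ℝ≥0∞) ^ k * 2 ^ k = 1 := fun k => by
    rw [← mul_pow, ENNReal.inv_mul_cancel two_ne_zero ENNReal.ofNat_ne_top, one_pow]
  set e : ℕ → ℝ≥0∞ := fun k => (2⁻¹ ^ k * (fundamental q v (r k))⁻¹) ^ (1 / q) with he
  have heq : ∀ k, e k ^ q = 2⁻¹ ^ k * (fundamental q v (r k))⁻¹ := fun k => by
    rw [he, ← ENNReal.rpow_mul, one_div_mul_cancel hq.ne', ENNReal.rpow_one]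
  have heφ : ∀ k, e k ^ q * fundamental q v (r k) = 2⁻¹ ^ k := fun k => by
    rw [heq, mul_assoc, ENNReal.inv_mul_cancel (hv0 _ (hr k)) (hvt _ (hr k)), mul_one]
  have het : ∀ k, e k ≠ ∞ := fun k => ENNReal.rpow_ne_top_of_nonneg (by positivity)
    (ENNReal.mul_ne_top (by simp) (ENNReal.inv_ne_top.2 (hv0 _ (hr k))))
  set c : ℕ → ℝ≥0∞ := fun k => 2⁻¹ ^ k * e k with hc
  set F := stepSum c r with hF
  have hFanti : Antitone F := stepSum_antitone c r
  have hNv : ∫⁻ t in Ioi 0, (v t : ℝ≥0∞) / ENNReal.ofReal t ^ q * (∫⁻ s in Ioc 0 t, F s) ^ q <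
      ∞ := by
    refine (lintegral_stepSum_rpow_le hq hv e het hr).trans_lt ?_
    simp only [heφ]
    rw [ENNReal.tsum_geometric, ENNReal.one_sub_inv_two, inv_inv]
    exact ENNReal.mul_lt_top (ENNReal.rpow_lt_top_of_nonneg hq.le ENNReal.ofNat_ne_top)
      ENNReal.ofNat_lt_top
  -- An infinite value at `s` would make `F` infinite on `(0, s)` and, as `φ_v(s) ≠ 0`, the norm for
  -- `v` infinite.
  have hFfin : ∀ s, 0 < s → F s ≠ ∞ := by
    intro s hs htop
    have h := rpow_mul_fundamental_le hq v hs fun x _ hxs => hFanti hxs.le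
    rw [htop, ENNReal.top_rpow_of_pos hq, ENNReal.top_mul (hv0 s hs)] at h
    exact absurd hNv (not_lt.2 h)
  have hfv : gammaIntegral q v (radial n F) < ∞ := by
    refine lt_of_le_of_lt ?_ hNv
    rw [gammaIntegral_eq hq]
    refine lintegral_mono fun t => ?_
    have h := setLIntegral_mono' (μ := volume) measurableSet_Ioc fun s (hs : s ∈ Ioc 0 t) =>
      rearrangement_radial_le hn hFanti hs.1
    exact mul_le_mul_right (ENNReal.rpow_le_rpow h hq.le) _
  have hfu := hsub _ (measurable_radial n hFanti) hfv
  -- The `k`-th hump alone already gives this bound.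
  have hlow : ∀ k : ℕ, (2 : ℝ≥0∞) ^ k ≤ gammaIntegral q u (radial n F) := by
    intro k
    rw [gammaIntegral_eq hq]
    refine le_trans ?_ (rpow_mul_fundamental_le hq u (hr k) fun s hs hsr =>
      le_rearrangement_radial hn hFfin (fun x _ hx => le_stepSum c r hx) hs hsr)
    calc (2 : ℝ≥0∞) ^ k = ((2⁻¹ : ℝ≥0∞) ^ k * 2 ^ k) ^ q * (2⁻¹ ^ k * 2 ^ k) * 2 ^ k := by
          simp [h2k]
      _ = c k ^ q * (((2 : ℝ≥0∞) ^ k) ^ q * (2 ^ k * 2 ^ k) * fundamental q v (r k)) := by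
          have hck : c k ^ q = ((2⁻¹ : ℝ≥0∞) ^ k) ^ q * e k ^ q :=
            ENNReal.mul_rpow_of_nonneg _ _ hq.le
          rw [hck, ENNReal.mul_rpow_of_nonneg _ _ hq.le]
          conv_lhs => enter [1, 2, 1]; rw [← heφ k]
          ring
      _ ≤ _ := by gcongr; exact (hlt k).le
  obtain ⟨k, hk⟩ := ENNReal.exists_nat_gt hfu.ne
  have hk2 : (k : ℝ≥0∞) ≤ 2 ^ k := by exact_mod_cast Nat.lt_two_pow_self.le
  exact absurd hk (not_lt.2 (hk2.trans (hlow k)))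

/-! ### Proof of the equivalences -/

/-- Degenerate case: decreasing averages force `w = 0` on `(0, ∞)`. Setting it aside ensures that
`φ_v` does not vanish when `v` is associated. -/
theorem memB_one_of_primitive_eq_zero {w : ℝ → ℝ≥0} (hdec : AntitoneOn w (Ioi 0)) {r : ℝ}
    (hr : 0 < r) (h : primitive w r = 0) : MemB 1 w := by
  have hzero : ∀ x, 0 < x → (w x : ℝ≥0∞) = 0 := by
    intro x hx
    refine nonpos_iff_eq_zero.1 ((le_average (coe_antitoneOn hdec) hx).trans ?_)
    rcases le_total x r with hxr | hrx
    · have h0 : primitive w x = 0 := nonpos_iff_eq_zero.1 (h ▸ primitive_mono w hxr)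
      simp only [primitive] at h0
      simp [h0]
    · exact (average_weight_antitoneOn hdec hr hx hrx).trans (by simp [average, h])
  refine memB_one_iff.2 ⟨0, fun s hs => ?_⟩
  rw [setLIntegral_congr_fun (g := fun _ => 0) measurableSet_Ioi fun x hx => by
    simp only [hzero x (lt_trans hs hx), ENNReal.zero_div]]
  simp

theorem memB_one_of_gammaSpace_subset {n : ℕ} (hn : 1 ≤ n) {q : ℝ} (hq : 1 < q) {w v : ℝ → ℝ≥0}
    (hw : IsWeight w) (hdec : AntitoneOn w (Ioi 0)) (hv : IsAssociatedWeight q w v)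
    (hsub : GammaSpace n q q v ⊆ GammaSpace n 1 q w) : MemB 1 w := by
  have hq0 : 0 < q := by linarith
  by_cases hpos : ∃ r, 0 < r ∧ primitive w r = 0
  · obtain ⟨r, hr, h⟩ := hpos
    exact memB_one_of_primitive_eq_zero hdec hr h
  push Not at hpos
  obtain ⟨C, -, hC, hC'⟩ := hv.2.exists_le
  have hφ0 : ∀ r : ℝ, 0 < r → fundamental q v r ≠ 0 := by
    intro r hr h0
    have h1 : primitive w r ^ q ≤ C * fundamental q v r := hC r hr
    rw [h0, mul_zero, nonpos_iff_eq_zero, ENNReal.rpow_eq_zero_iff_of_pos hq0] at h1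
    exact hpos r hr h1
  have hφt : ∀ r : ℝ, 0 < r → fundamental q v r ≠ ∞ := fun r hr =>
    ne_top_of_le_ne_top (ENNReal.mul_ne_top ENNReal.coe_ne_top
      (ENNReal.rpow_ne_top_of_nonneg hq0.le (primitive_ne_top hw hr))) (hC' r hr)
  obtain ⟨K, hK, hle⟩ := fundamental_le_of_subset (u := powerWeight q w) hn hq0 hv.1.1 hφ0 hφt
    fun f hf hfin => by
      have h1 : f ∈ GammaSpace n q q v := ⟨hf.aemeasurable, by
        rw [gammaNorm_self hq0.ne']
        exact ENNReal.rpow_lt_top_of_nonneg (by positivity) hfin.ne⟩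
      have h2 := (hsub h1).2
      rwa [gammaNorm_one hq hw, ENNReal.rpow_lt_top_iff_of_pos (by positivity)] at h2
  refine memB_one_of_fundamental_le hq hw hdec (K := K * C)
    (ENNReal.mul_ne_top hK ENNReal.coe_ne_top) fun r hr => (hle r hr).trans ?_
  rw [mul_assoc]
  exact mul_le_mul_right (hC' r hr) K

/-- Any two associated weights have fundamental functions comparable through `W^q`, and under `B_1`
the weight `W^(q-1) w` is one of them. -/
theorem gammaNorm_equivalentOn {n : ℕ} {q : ℝ} (hq : 1 < q) {w v : ℝ → ℝ≥0}
    (hw : IsWeight w) (hdec : AntitoneOn w (Ioi 0)) (hB : MemB 1 w)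
    (hv : IsAssociatedWeight q w v) :
    EquivalentOn {f : EuclideanSpace ℝ (Fin n) → ℝ≥0 | AEMeasurable f volume}
      (gammaNorm 1 q w) (gammaNorm q q v) := by
  have hq0 : 0 < q := by linarith
  have hu := isAssociatedWeight_powerWeight hq hw hdec hB
  have key : ∀ v₁ v₂ : ℝ → ℝ≥0, IsAssociatedWeight q w v₁ → IsAssociatedWeight q w v₂ →
      ∃ C : ℝ≥0∞, C ≠ ∞ ∧ ∀ f : EuclideanSpace ℝ (Fin n) → ℝ≥0,
        gammaIntegral q v₁ f ^ (1 / q) ≤ C * gammaIntegral q v₂ f ^ (1 / q) := by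
    intro v₁ v₂ h₁ h₂
    obtain ⟨C₁, -, -, hC₁⟩ := h₁.2.exists_le
    obtain ⟨C₂, -, hC₂, -⟩ := h₂.2.exists_le
    have h2 : (2 : ℝ≥0∞) ^ q ≠ ∞ := ENNReal.rpow_ne_top_of_nonneg hq0.le ENNReal.ofNat_ne_top
    have hC : (C₁ * C₂ : ℝ≥0∞) ≠ ∞ := ENNReal.mul_ne_top ENNReal.coe_ne_top ENNReal.coe_ne_top
    refine ⟨(2 ^ q * (C₁ * C₂ * 2 ^ q)) ^ (1 / q), ENNReal.rpow_ne_top_of_nonneg (by positivity)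
      (ENNReal.mul_ne_top h2 (ENNReal.mul_ne_top hC h2)), fun f => ?_⟩
    rw [← ENNReal.mul_rpow_of_nonneg _ _ (by positivity)]
    refine ENNReal.rpow_le_rpow ?_ (by positivity)
    refine gammaIntegral_le_of_fundamental_le hq h₂.1.1 h₁.1.1 hC (fun r hr => ?_) f
    rw [mul_assoc]
    exact (hC₁ r hr).trans (mul_le_mul_right (hC₂ r hr) _)
  obtain ⟨C, hC, hC'⟩ := key _ _ hu hv
  obtain ⟨D, hD, hD'⟩ := key _ _ hv hu
  refine equivalentOn_of_le hC hD (fun f _ => ?_) fun f _ => ?_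
  · rw [gammaNorm_one hq hw, gammaNorm_self hq0.ne']
    exact hC' f
  · rw [gammaNorm_one hq hw, gammaNorm_self hq0.ne']
    exact hD' f

theorem gammaSpace_eq_of_equivalentOn {n : ℕ} {q : ℝ} {w v : ℝ → ℝ≥0}
    (h : EquivalentOn {f : EuclideanSpace ℝ (Fin n) → ℝ≥0 | AEMeasurable f volume}
      (gammaNorm 1 q w) (gammaNorm q q v)) : GammaSpace n 1 q w = GammaSpace n q q v := by
  obtain ⟨C, -, h1, h2⟩ := h.exists_le
  ext f
  exact ⟨fun hf => ⟨hf.1, (h2 f hf.1).trans_lt (ENNReal.mul_lt_top ENNReal.coe_lt_top hf.2)⟩,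
    fun hf => ⟨hf.1, (h1 f hf.1).trans_lt (ENNReal.mul_lt_top ENNReal.coe_lt_top hf.2)⟩⟩

end Lorentz

theorem mainTheorem8 (n : ℕ) (hn : 1 ≤ n) (w : ℝ → ℝ≥0) (hw : Lorentz.IsWeight w)
    (hdec : AntitoneOn w (Ioi 0)) :
    -- equality of the spaces as sets, for some choice of the weights `w_q`
    (Lorentz.MemB 1 w ↔
      ∀ q : ℝ, 1 < q → ∃ v : ℝ → ℝ≥0, Lorentz.IsAssociatedWeight q w v ∧
        Lorentz.GammaSpace n 1 q w = Lorentz.GammaSpace n q q v) ∧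
    -- equality of the spaces with equivalent norms, for every choice of the weights `w_q`
    (Lorentz.MemB 1 w ↔
      ∀ q : ℝ, 1 < q →
        (∃ v : ℝ → ℝ≥0, Lorentz.IsAssociatedWeight q w v) ∧
        ∀ v : ℝ → ℝ≥0, Lorentz.IsAssociatedWeight q w v →
          Lorentz.GammaSpace n 1 q w = Lorentz.GammaSpace n q q v ∧
          Lorentz.EquivalentOn
            {f : EuclideanSpace ℝ (Fin n) → ℝ≥0 | AEMeasurable f volume}
            (Lorentz.gammaNorm 1 q w) (Lorentz.gammaNorm q q v)) := by
  have hassoc : Lorentz.MemB 1 w → ∀ q : ℝ, 1 < q →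
      (∃ v : ℝ → ℝ≥0, Lorentz.IsAssociatedWeight q w v) ∧
      ∀ v : ℝ → ℝ≥0, Lorentz.IsAssociatedWeight q w v →
        Lorentz.GammaSpace n 1 q w = Lorentz.GammaSpace n q q v ∧
        Lorentz.EquivalentOn
          {f : EuclideanSpace ℝ (Fin n) → ℝ≥0 | AEMeasurable f volume}
          (Lorentz.gammaNorm 1 q w) (Lorentz.gammaNorm q q v) := fun hB q hq =>
    ⟨⟨_, Lorentz.isAssociatedWeight_powerWeight hq hw hdec hB⟩, fun v hv =>
      have h := Lorentz.gammaNorm_equivalentOn hq hw hdec hB hv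
      ⟨Lorentz.gammaSpace_eq_of_equivalentOn h, h⟩⟩
  have hset : (∀ q : ℝ, 1 < q → ∃ v : ℝ → ℝ≥0, Lorentz.IsAssociatedWeight q w v ∧
      Lorentz.GammaSpace n 1 q w = Lorentz.GammaSpace n q q v) → Lorentz.MemB 1 w := fun h => by
    -- A single exponent is enough; any `q > 1` would serve.
    obtain ⟨v, hv, heq⟩ := h 2 one_lt_two
    exact Lorentz.memB_one_of_gammaSpace_subset hn one_lt_two hw hdec hv heq.symm.subset
  refine ⟨⟨fun hB q hq => ?_, hset⟩, ⟨hassoc, fun h => hset fun q hq => ?_⟩⟩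
  · obtain ⟨⟨v, hv⟩, h⟩ := hassoc hB q hq
    exact ⟨v, hv, (h v hv).1⟩
  · obtain ⟨⟨v, hv⟩, h'⟩ := h q hq
    exact ⟨v, hv, (h' v hv).1⟩
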